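/- An r.p.o. tree (relational predecessor tree with ordering) is a structure $\mathcal T=(T,P,<,r)$ with $r\in T$ such that: (1) $(T,P)$ is a directed graph whose underlying undirected graph is connected and acyclic and all of whose edges are oriented towards the root $r$ (thus $P(x,y)$ says that $x$ is a child of $y$, and $r$ has no parent); (2) $<$ is a strict partial order on $T$ such that two distinct nodes are comparable if and only if they have the same parent. The depth of the root is $0$, and a child of a node of depth $n$ has depth $n+1$; $\mathcal T$ has unbounded depth if it has nodes of arbitrarily large depth. The tree $\mathcal T$ is computable if $T$ is a computable subset of $\mathbb N$ and the relations $P$ and $<$ are computable. A structure of this signature is fully P-TIME if its domain is the set $\{0,1\}^{<\omega}$ of all finite binary strings and its two binary relations are decidable by Turing machines in time polynomial in the length of the input. Theorem. The class of r.p.o. trees of unbounded depth is P-TIME robust. That is, every computable r.p.o. tree $\mathcal T=(T,P,<,r)$ of unbounded depth is isomorphic, as a structure with the relations $P$ and $<$ and the constant $r$, to a fully P-TIME structure. -/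

import Mathlib

/-- A structure in the signature of r.p.o. trees: a binary relation `Pred` (where `Pred x y` means
that `y` is the immediate predecessor, i.e. the parent, of `x`), a binary relation `Lt`, and a
constant `root`. -/
structure TreeStr (α : Type) where
  /-- `Pred x y`: the node `x` is a child of the node `y`. -/
  Pred : α → α → Prop
  /-- The (strict) ordering of siblings. -/
  Lt : α → α → Prop
  /-- The root. -/
  root : α

namespace TreeStr

/-- The underlying undirected graph of the directed graph given by `Pred`. -/
def graph {α : Type} (S : TreeStr α) : SimpleGraph α :=
  SimpleGraph.fromRel S.Pred

/-- Relational predecessor trees with ordering (r.p.o. trees). -/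
structure IsRPOTree {α : Type} (S : TreeStr α) : Prop where
  /-- The underlying undirected graph is connected and acyclic. -/
  isTree : S.graph.IsTree
  /-- All edges are oriented towards the root: the target of an edge is one step closer to the
  root than its source. In particular there are no loops, and the root has no parent. -/
  towards_root : ∀ x y, S.Pred x y → S.graph.dist x S.root = S.graph.dist y S.root + 1
  /-- The ordering is a (strict) partial ordering. -/
  lt_irrefl : ∀ x, ¬ S.Lt x x
  lt_trans : ∀ x y z, S.Lt x y → S.Lt y z → S.Lt x z
  /-- Two distinct nodes are comparable exactly when they have the same parent. -/
  comparable_iff : ∀ x y, x ≠ y → ((S.Lt x y ∨ S.Lt y x) ↔ ∃ z, S.Pred x z ∧ S.Pred y z)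

/-- `S.HasDepth a n`: the node `a` has depth `n`. The root has depth `0`, and a child of a node of
depth `n` has depth `n + 1`. -/
inductive HasDepth {α : Type} (S : TreeStr α) : α → ℕ → Prop
  | root : HasDepth S S.root 0
  | child {a b : α} {n : ℕ} : S.Pred b a → HasDepth S a n → HasDepth S b (n + 1)

/-- There are nodes of arbitrarily large depth. -/
def UnboundedDepth {α : Type} (S : TreeStr α) : Prop :=
  ∀ n : ℕ, ∃ a m, n ≤ m ∧ S.HasDepth a m

/-- A structure whose domain is a set `D` of natural numbers is computable if `D` is a computable
set and the relations of the structure are computable. -/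
structure IsComputable {D : Set ℕ} (S : TreeStr D) : Prop where
  dom : ComputablePred fun n : ℕ => n ∈ D
  pred : ComputablePred fun p : ℕ × ℕ =>
    ∃ (hx : p.1 ∈ D) (hy : p.2 ∈ D), S.Pred ⟨p.1, hx⟩ ⟨p.2, hy⟩
  lt : ComputablePred fun p : ℕ × ℕ =>
    ∃ (hx : p.1 ∈ D) (hy : p.2 ∈ D), S.Lt ⟨p.1, hx⟩ ⟨p.2, hy⟩

open Classical in
/-- A binary relation on finite binary strings is polynomial-time computable if some (multi-stack)
Turing machine decides it in time polynomial in the total length of the two input strings. -/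
def PTimeRel (R : List Bool → List Bool → Prop) : Prop :=
  Nonempty (Turing.TM2ComputableInPolyTime
    (Computability.encodingProd (Computability.encodingList Bool)
      (Computability.encodingList Bool)).encode
    Computability.encodingBoolBool.encode
    fun p : List Bool × List Bool => decide (R p.1 p.2))

/-- A structure is fully P-TIME if its domain is the set of all finite binary strings and its
relations are polynomial-time computable. -/
structure IsFullyPTime (S : TreeStr (List Bool)) : Prop where
  pred : PTimeRel S.Pred
  lt : PTimeRel S.Lt

/-- Isomorphisms of structures in the signature of r.p.o. trees. -/
structure Iso {α β : Type} (S : TreeStr α) (T : TreeStr β) extends α ≃ β where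
  map_pred : ∀ x y, T.Pred (toFun x) (toFun y) ↔ S.Pred x y
  map_lt : ∀ x y, T.Lt (toFun x) (toFun y) ↔ S.Lt x y
  map_root : toFun S.root = T.root

/-- A structure is fully P-TIME presentable if it is isomorphic to a fully P-TIME structure. -/
def FullyPTimePresentable {α : Type} (S : TreeStr α) : Prop :=
  ∃ R : TreeStr (List Bool), R.IsFullyPTime ∧ Nonempty (S.Iso R)

end TreeStr

/-! The proof pads strings. Every binary string is uniquely `str t m`: the binary expansion of `m`,
least significant bit first, followed by `t` zeros. Fix a fast-growing `τ`. For each `m` the one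
string with `t = τ m` is the padded string of `m` and gets the even number `2 * m`; all other
strings are numbered by the odd numbers (`bijective_pos_zeroArg`). Thus even positions can be made
to have strings as long as desired, while nothing is demanded of the strings at odd positions.

Since parents, children and siblings differ in depth by at most one, unbounded depth provides, for
every finite set of nodes, a new node neither adjacent nor sibling to any of them
(`exists_not_near`). Hence the nodes have a computable enumeration `e` in which every odd entry is
unrelated to all earlier entries, while even stages take the least node not yet listed
(`exists_enumeration`). If two entries are related, the later one has an even position `2 * m`, so
its string contains `τ m` trailing zeros. Choosing `τ m` above the time needed to decide both
relations on all positions up to `2 * m`, the input is long enough to pay for the decision. A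
machine may therefore run the decision procedure for as many steps as there are input symbols and
reject on timeout: related pairs never time out (`exists_pTimeRel`).

The machine must also recognise padded strings. For this `τ m` is itself the running time of a
program `c₁` on `m`: running `c₁` for `t` steps compares `t` with `τ m` in linear time. Such a `τ`
exists above any computable bound, because a program with a long output must run long
(`exists_code_le_runtime`). The programs are those of Mathlib's stack machine `tr`, simulated step
by step with a clock (`within_machine`, `pTimeRel_of_codes`). -/

namespace Turing.PartrecToTM2
-- Running time and stack growth of the universal stack machine.
open StateTransition

/-- One step of the universal stack machine, where halting configurations are fixed points. -/
def next (C : Cfg') : Cfg' := (TM2.step tr C).getD C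

/-- The number of steps until the universal stack machine halts. -/
noncomputable def runtime (C : Cfg') : ℕ := sInf {n | (next^[n] C).l = none}

theorem next_of_none {C : Cfg'} (h : C.l = none) : next C = C := by
  rcases C with ⟨l, v, S⟩
  cases h
  rfl

theorem next_some (l : Λ') (v : Option Γ') (T : K' → List Γ') :
    next ⟨some l, v, T⟩ = TM2.stepAux (tr l) v T := rfl

theorem iterate_next_of_none {C : Cfg'} (h : C.l = none) (n : ℕ) : next^[n] C = C :=
  Function.iterate_fixed (next_of_none h) n

theorem exists_iterate_of_reaches {C D : Cfg'} (h : Reaches (TM2.step tr) C D) :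
    ∃ n, next^[n] C = D := by
  induction h with
  | refl => exact ⟨0, rfl⟩
  | tail _ hs ih =>
    obtain ⟨n, rfl⟩ := ih
    refine ⟨n + 1, ?_⟩
    rw [Function.iterate_succ_apply', next, Option.mem_def.1 hs]
    rfl

theorem exists_iterate_eq_halt {c : ToPartrec.Code} {v w : List ℕ} (h : c.eval v = pure w) :
    ∃ n, next^[n] (init c v) = halt w := by
  have : halt w ∈ eval (TM2.step tr) (init c v) := by
    rw [tr_eval, h]
    exact (Part.mem_map_iff _).2 ⟨w, Part.mem_some _, rfl⟩
  exact exists_iterate_of_reaches (mem_eval.1 this).1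

theorem iterate_runtime_l {C : Cfg'} (h : ∃ n, (next^[n] C).l = none) :
    (next^[runtime C] C).l = none :=
  Nat.sInf_mem (s := {n | (next^[n] C).l = none}) h

theorem runtime_le {C : Cfg'} {n : ℕ} (h : (next^[n] C).l = none) : runtime C ≤ n :=
  Nat.sInf_le h

theorem iterate_l_of_le {C : Cfg'} {m n : ℕ} (h : (next^[m] C).l = none) (hmn : m ≤ n) :
    next^[n] C = next^[m] C := by
  obtain ⟨k, rfl⟩ := Nat.exists_eq_add_of_le hmn
  rw [add_comm, Function.iterate_add_apply, iterate_next_of_none h]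

theorem iterate_runtime_of_halt {C : Cfg'} {w : List ℕ} (h : ∃ n, next^[n] C = halt w) :
    next^[runtime C] C = halt w := by
  obtain ⟨n, hn⟩ := h
  have hn' : (next^[n] C).l = none := by rw [hn]; rfl
  rw [← hn]
  exact (iterate_l_of_le (iterate_runtime_l ⟨n, hn'⟩) (runtime_le hn')).symm

/-- The largest number of symbols that a statement may push on a stack. -/
def pushes {K : Type} {Γ : K → Type} {Λ σ : Type} : TM2.Stmt Γ Λ σ → ℕ
  | .push _ _ q => pushes q + 1
  | .peek _ _ q => pushes q
  | .pop _ _ q => pushes q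
  | .load _ q => pushes q
  | .branch _ q₁ q₂ => max (pushes q₁) (pushes q₂)
  | .goto _ => 0
  | .halt => 0

theorem length_stepAux_le {K : Type} [DecidableEq K] {Γ : K → Type} {Λ σ : Type}
    (q : TM2.Stmt Γ Λ σ) (v : σ) (S : ∀ k, List (Γ k)) (k : K) :
    ((TM2.stepAux q v S).stk k).length ≤ (S k).length + pushes q := by
  induction q generalizing v S with
  | push k' f q ih =>
    refine (ih _ _).trans ?_
    by_cases h : k = k'
    · subst h; simp [pushes]; omega
    · simp [pushes, h]
  | peek k' f q ih => exact ih _ _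
  | pop k' f q ih =>
    refine (ih _ _).trans ?_
    by_cases h : k = k'
    · subst h; simp [pushes]
    · simp [pushes, h]
  | load f q ih => exact ih _ _
  | branch f q₁ q₂ ih₁ ih₂ =>
    rw [TM2.stepAux]
    cases f v
    · exact (ih₂ _ _).trans (by simp [pushes])
    · exact (ih₁ _ _).trans (by simp [pushes])
  | goto f => simp [pushes]
  | halt => simp [pushes]

theorem pushes_tr_le (l : Λ') : pushes (tr l) ≤ 2 := by
  cases l with
  | ret k => cases k <;> simp [tr, pushes]
  | _ => simp [tr, pushes]

theorem length_next_le (C : Cfg') (k : K') : ((next C).stk k).length ≤ (C.stk k).length + 2 := by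
  rcases C with ⟨_ | l, v, S⟩
  · exact Nat.le_add_right _ _
  · exact (length_stepAux_le (tr l) v S k).trans (Nat.add_le_add_left (pushes_tr_le l) _)

/-- Read forwards, this bounds the cost of clearing the stacks after a simulation; read backwards,
it bounds the running time from below by the length of the output. -/
theorem length_iterate_next_le (C : Cfg') (k : K') (n : ℕ) :
    ((next^[n] C).stk k).length ≤ (C.stk k).length + 2 * n := by
  induction n with
  | zero => simp
  | succ n ih =>
    rw [Function.iterate_succ_apply']
    have := length_next_le (next^[n] C) k
    omega

/-- The label of a configuration belongs to `S`, or the configuration has halted. -/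
def LabelIn (S : Finset Λ') (C : Cfg') : Prop := ∀ l ∈ C.l, l ∈ S

theorem labelIn_stepAux {S : Finset Λ'} (q : Stmt') (v : Option Γ') (T : K' → List Γ')
    (h : TM2.SupportsStmt S q) : LabelIn S (TM2.stepAux q v T) := by
  induction q generalizing v T with
  | push k' f q ih => exact ih _ _ h
  | peek k' f q ih => exact ih _ _ h
  | pop k' f q ih => exact ih _ _ h
  | load f q ih => exact ih _ _ h
  | branch f q₁ q₂ ih₁ ih₂ =>
    rw [TM2.stepAux]
    cases f v
    · exact ih₂ _ _ h.2
    · exact ih₁ _ _ h.1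
  | goto f =>
    rintro l hl
    cases hl
    exact h v
  | halt =>
    rintro l hl
    cases hl

/-- `S` is closed under the jumps of the universal stack machine. -/
def Closed (S : Finset Λ') : Prop := ∀ l ∈ S, TM2.SupportsStmt S (tr l)

theorem LabelIn.next {S : Finset Λ'} (hS : Closed S) {C : Cfg'} (h : LabelIn S C) :
    LabelIn S (next C) := by
  rcases C with ⟨_ | l, v, T⟩
  · exact h
  · exact labelIn_stepAux _ _ _ (hS l (h l rfl))

theorem supportsStmt_mono {S T : Finset Λ'} (hST : S ⊆ T) (q : Stmt')
    (h : TM2.SupportsStmt S q) : TM2.SupportsStmt T q := by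
  induction q with
  | push k' f q ih => exact ih h
  | peek k' f q ih => exact ih h
  | pop k' f q ih => exact ih h
  | load f q ih => exact ih h
  | branch f q₁ q₂ ih₁ ih₂ => exact ⟨ih₁ h.1, ih₂ h.2⟩
  | goto f => exact fun v => hST (h v)
  | halt => trivial

theorem Closed.union {S T : Finset Λ'} (hS : Closed S) (hT : Closed T) : Closed (S ∪ T) := by
  intro l hl
  rcases Finset.mem_union.1 hl with hl | hl
  · exact supportsStmt_mono Finset.subset_union_left _ (hS l hl)
  · exact supportsStmt_mono Finset.subset_union_right _ (hT l hl)

/-- The label type `Λ'` is infinite, but a fixed code only visits the finite set `codeSupp`. This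
makes a finite machine possible, and also a coding of configurations by numbers. -/
theorem closed_codeSupp (c : ToPartrec.Code) (k : Cont') : Closed (codeSupp c k) :=
  (tr_supports c k).2

theorem trNormal_mem_codeSupp (c : ToPartrec.Code) (k : Cont') : trNormal c k ∈ codeSupp c k :=
  (tr_supports c k).1

end Turing.PartrecToTM2

/-! ### Computability of the running time. -/

namespace Turing.PartrecToTM2

/-- A coding of a finite type. -/
noncomputable abbrev finitePrimcodable (α : Type) [Finite α] : Primcodable α :=
  Primcodable.ofEquiv _ (Finite.equivFin α)

noncomputable instance : Primcodable Γ' := finitePrimcodable Γ'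

noncomputable instance (S : Finset Λ') : Primcodable {l // l ∈ S} := finitePrimcodable _

/-- A function of two arguments, the first of which ranges over a finite type, is primitive
recursive if all its sections are. -/
theorem primrec_of_sections {α β γ : Type} [Primcodable α] [Finite α] [Primcodable β]
    [Primcodable γ] {f : α → β → γ} (h : ∀ a, Primrec (f a)) : Primrec₂ f := by
  obtain ⟨n, ⟨e⟩⟩ := Finite.exists_equiv_fin α
  -- Tabulate all sections at `b`, then look up the entry of the first argument.
  have h₁ : Primrec fun b => List.Vector.ofFn fun i => f (e.symm i) b :=
    Primrec.vector_ofFn fun i => h _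
  have h₂ : Primrec e := Primrec.dom_finite e
  refine (Primrec.vector_get.comp (h₁.comp Primrec.snd) (h₂.comp Primrec.fst)).of_eq fun p => ?_
  simp

/-- The contents of the four stacks. -/
abbrev Stacks : Type := List Γ' × List Γ' × List Γ' × List Γ'

/-- The stacks as a function. -/
def Stacks.toFun (T : Stacks) : K' → List Γ' := K'.elim T.1 T.2.1 T.2.2.1 T.2.2.2

/-- The stacks as a tuple. -/
def Stacks.ofFun (T : K' → List Γ') : Stacks := (T .main, T .rev, T .aux, T .stack)

theorem Stacks.toFun_ofFun (T : K' → List Γ') : (Stacks.ofFun T).toFun = T := by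
  funext k; cases k <;> rfl

theorem Stacks.ofFun_toFun (T : Stacks) : Stacks.ofFun T.toFun = T := rfl

theorem primrec_toFun (k : K') : Primrec fun T : Stacks => T.toFun k := by
  have h := Primrec.snd (α := List Γ') (β := List Γ' × List Γ' × List Γ')
  have h' := Primrec.snd (α := List Γ') (β := List Γ' × List Γ')
  cases k
  · exact Primrec.fst
  · exact Primrec.fst.comp h
  · exact Primrec.fst.comp (h'.comp h)
  · exact Primrec.snd.comp (h'.comp h)

theorem primrec_update {α : Type} [Primcodable α] (k : K') {f : α → Stacks} {g : α → List Γ'}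
    (hf : Primrec f) (hg : Primrec g) :
    Primrec fun a => Stacks.ofFun (Function.update (f a).toFun k (g a)) := by
  have h (k' : K') : Primrec fun a => Function.update (f a).toFun k (g a) k' := by
    by_cases hk : k' = k
    · subst hk; simpa using hg
    · simpa [hk] using (primrec_toFun k').comp hf
  exact ((h _).pair ((h _).pair ((h _).pair (h _))))

/-- The configurations with labels in `S`. -/
abbrev FinCfg (S : Finset Λ') : Type := (Option {l // l ∈ S} × Option Γ') × Stacks

open Classical in
/-- Restriction of a configuration to the labels in `S`. -/
noncomputable def toFinCfg (S : Finset Λ') (C : Cfg') : FinCfg S :=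
  ((C.l.bind fun l => if h : l ∈ S then some ⟨l, h⟩ else none, C.var), Stacks.ofFun C.stk)

/-- The statement `q` is fixed, so the functions inside it act on finite types and are primitive
recursive for free; only the stack operations need an argument. -/
theorem primrec_stepAux (S : Finset Λ') (q : Stmt') :
    Primrec fun p : Option Γ' × Stacks => toFinCfg S (TM2.stepAux q p.1 p.2.toFun) := by
  induction q with
  | push k f q ih =>
    have h : Primrec fun p : Option Γ' × Stacks => f p.1 :=
      (Primrec.dom_finite f).comp Primrec.fst
    refine (ih.comp (Primrec.fst.pair (primrec_update k Primrec.snd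
      (Primrec.list_cons.comp h ((primrec_toFun k).comp Primrec.snd))))).of_eq fun p => ?_
    rw [Stacks.toFun_ofFun]
    rfl
  | peek k f q ih =>
    have h : Primrec fun p : Option Γ' × Stacks => f p.1 (p.2.toFun k).head? :=
      (Primrec.dom_finite (Function.uncurry f)).comp
        (Primrec.fst.pair (Primrec.list_head?.comp ((primrec_toFun k).comp Primrec.snd)))
    exact (ih.comp (h.pair Primrec.snd)).of_eq fun p => rfl
  | pop k f q ih =>
    have h : Primrec fun p : Option Γ' × Stacks => f p.1 (p.2.toFun k).head? :=
      (Primrec.dom_finite (Function.uncurry f)).comp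
        (Primrec.fst.pair (Primrec.list_head?.comp ((primrec_toFun k).comp Primrec.snd)))
    refine (ih.comp (h.pair (primrec_update k Primrec.snd
      (Primrec.list_tail.comp ((primrec_toFun k).comp Primrec.snd))))).of_eq fun p => ?_
    rw [Stacks.toFun_ofFun]
    rfl
  | load f q ih =>
    exact ih.comp (((Primrec.dom_finite f).comp Primrec.fst).pair Primrec.snd)
  | branch f q₁ q₂ ih₁ ih₂ =>
    refine (Primrec.cond ((Primrec.dom_finite f).comp Primrec.fst) ih₁ ih₂).of_eq fun p => ?_
    simp only [TM2.stepAux]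
    cases f p.1 <;> rfl
  | goto f =>
    exact (((Primrec.dom_finite fun v => Option.bind (some (f v))
      fun l => if h : l ∈ S then some (⟨l, h⟩ : {l // l ∈ S}) else none).comp
        Primrec.fst).pair Primrec.fst).pair Primrec.snd |>.of_eq fun p => by
          simp [toFinCfg, TM2.stepAux, Stacks.ofFun_toFun]
  | halt =>
    exact ((Primrec.const none).pair Primrec.fst).pair Primrec.snd

/-- The step function on configurations with labels in `S`. -/
noncomputable def finNext (S : Finset Λ') (C : FinCfg S) : FinCfg S :=
  C.1.1.elim C fun l => toFinCfg S (TM2.stepAux (tr l) C.1.2 C.2.toFun)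

theorem primrec_finNext (S : Finset Λ') : Primrec (finNext S) := by
  have h : Primrec₂ fun (l : {l // l ∈ S}) (p : Option Γ' × Stacks) =>
      toFinCfg S (TM2.stepAux (tr l) p.1 p.2.toFun) :=
    primrec_of_sections fun l => primrec_stepAux S (tr l)
  refine (Primrec.option_casesOn (o := fun C : FinCfg S => C.1.1) (f := fun C => C)
    (g := fun C l => toFinCfg S (TM2.stepAux (tr l) C.1.2 C.2.toFun))
    (Primrec.fst.comp Primrec.fst) Primrec.id ?_).of_eq fun C => ?_
  · exact h.comp Primrec.snd (((Primrec.snd.comp Primrec.fst).pair Primrec.snd).comp Primrec.fst)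
  · unfold finNext
    cases C.1.1 <;> rfl

/-- `LabelIn` is essential: `toFinCfg` turns a label outside `S` into a halted configuration. -/
theorem toFinCfg_next {S : Finset Λ'} {C : Cfg'} (h : LabelIn S C) :
    toFinCfg S (next C) = finNext S (toFinCfg S C) := by
  rcases C with ⟨_ | l, v, T⟩
  · rfl
  · have hl : l ∈ S := h l rfl
    simp [toFinCfg, finNext, hl, Stacks.toFun_ofFun, next_some]

theorem toFinCfg_iterate {S : Finset Λ'} (hS : Closed S) {C : Cfg'} (h : LabelIn S C) (n : ℕ) :
    toFinCfg S (next^[n] C) = (finNext S)^[n] (toFinCfg S C) ∧ LabelIn S (next^[n] C) := by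
  induction n with
  | zero => exact ⟨rfl, h⟩
  | succ n ih =>
    rw [Function.iterate_succ_apply', Function.iterate_succ_apply']
    exact ⟨by rw [toFinCfg_next ih.2, ih.1], ih.2.next hS⟩

theorem toFinCfg_l_eq_none {S : Finset Λ'} {C : Cfg'} (h : LabelIn S C) :
    (toFinCfg S C).1.1 = none ↔ C.l = none := by
  rcases C with ⟨_ | l, v, T⟩
  · simp [toFinCfg]
  · have hl : l ∈ S := h l rfl
    simp [toFinCfg, hl]

theorem trNat_eq (n : ℕ) : trNat n =
    if n = 0 then [] else (if n.bodd then Γ'.bit1 else Γ'.bit0) :: trNat n.div2 := by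
  have key (a : Num) : trNum a = if (a : ℕ) = 0 then [] else
      (if (a : ℕ).bodd then Γ'.bit1 else Γ'.bit0) :: trNat (a : ℕ).div2 := by
    rcases a with _ | (_ | p | p)
    · rfl
    · simp [trNum, trPosNum]
    · have h : ((Num.pos p.bit1 : Num) : ℕ) = Nat.bit true (p : ℕ) := by
        simp [Nat.bit, two_mul]
      simp [h, trNum, trPosNum, trNat]
    · have h : ((Num.pos p.bit0 : Num) : ℕ) = Nat.bit false (p : ℕ) := by
        simp [Nat.bit, two_mul]
      have h0 : (p : ℕ) ≠ 0 := (PosNum.cast_pos (α := ℕ) p).ne'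
      simp [h, trNum, trPosNum, trNat, h0]
  simpa [trNat] using key (n : Num)

theorem primrec_trNat : Primrec trNat := by
  have : Primrec₂ fun (_ : Unit) (n : ℕ) => trNat n := by
    -- Course-of-values recursion: `L` lists the values at all smaller arguments, so `L.length` is
    -- the current argument.
    refine Primrec.nat_strong_rec _ (g := fun _ L => if L.length = 0 then some [] else
      (L[L.length.div2]?).map fun l => (if L.length.bodd then Γ'.bit1 else Γ'.bit0) :: l) ?_ ?_
    · have hlen : Primrec fun p : Unit × List (List Γ') => p.2.length :=
        Primrec.list_length.comp Primrec.snd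
      refine Primrec.ite (Primrec.eq.comp hlen (Primrec.const 0)) (Primrec.const _) ?_
      refine Primrec.option_map (Primrec.list_getElem?.comp Primrec.snd
        (Primrec.nat_div2.comp hlen)) ?_
      refine Primrec.list_cons.comp ?_ Primrec.snd
      refine ((Primrec.cond (Primrec.nat_bodd.comp (hlen.comp Primrec.fst))
        (Primrec.const Γ'.bit1) (Primrec.const Γ'.bit0))).of_eq fun p => ?_
      cases p.1.2.length.bodd <;> rfl
    · intro _ n
      rw [trNat_eq n]
      by_cases hn : n = 0
      · simp [hn]
      · have : n.div2 < n := by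
          rw [Nat.div2_val]; omega
        simp [hn, this]
  exact this.comp (Primrec.const ()) Primrec.id

theorem primrec_trList : Primrec trList := by
  have : Primrec fun l : List ℕ => l.foldr (fun n L => trNat n ++ Γ'.cons :: L) [] := by
    refine Primrec.list_foldr (h := fun _ p => trNat p.1 ++ Γ'.cons :: p.2) Primrec.id
      (Primrec.const []) ?_
    exact Primrec.list_append.comp (primrec_trNat.comp (Primrec.fst.comp Primrec.snd))
      (Primrec.list_cons.comp (Primrec.const _) (Primrec.snd.comp Primrec.snd))
  refine this.of_eq fun l => ?_
  induction l with
  | nil => rfl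
  | cons n l ih => simp [ih]

theorem labelIn_init (c : ToPartrec.Code) (v : List ℕ) :
    LabelIn (codeSupp c Cont'.halt) (init c v) := by
  rintro l hl
  cases hl
  exact trNormal_mem_codeSupp c _

theorem primrec_toFinCfg_init (c : ToPartrec.Code) :
    Primrec fun v => toFinCfg (codeSupp c Cont'.halt) (init c v) := by
  have h : Primrec fun v : List ℕ => (((some ⟨_, trNormal_mem_codeSupp c _⟩, none),
      (trList v, [], [], [])) : FinCfg (codeSupp c Cont'.halt)) :=
    Primrec.pair (Primrec.const _) (primrec_trList.pair (Primrec.const _))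
  refine h.of_eq fun v => ?_
  have := trNormal_mem_codeSupp c Cont'.halt
  simp only [toFinCfg, init, Option.bind_some, this, dite_true]
  rfl

theorem computablePred_halted (c : ToPartrec.Code) {α : Type} [Primcodable α] {f : α → List ℕ}
    (hf : Computable f) :
    ComputablePred fun p : α × ℕ => (next^[p.2] (init c (f p.1))).l = none := by
  have hi : Primrec₂ fun (v : List ℕ) (n : ℕ) =>
      (finNext (codeSupp c Cont'.halt))^[n] (toFinCfg _ (init c v)) :=
    Primrec.nat_iterate Primrec.snd ((primrec_toFinCfg_init c).comp Primrec.fst)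
      ((primrec_finNext _).comp Primrec.snd)
  have hit : Computable₂ fun (a : α) (n : ℕ) =>
      (finNext (codeSupp c Cont'.halt))^[n] (toFinCfg _ (init c (f a))) :=
    hi.to_comp.comp (hf.comp Computable.fst) Computable.snd
  have hb : Primrec fun C : FinCfg (codeSupp c Cont'.halt) => !C.1.1.isSome :=
    Primrec.not.comp (Primrec.option_isSome.comp (Primrec.fst.comp Primrec.fst))
  refine ComputablePred.computable_iff.2 ⟨_, hb.to_comp.comp hit, ?_⟩
  funext p
  have := toFinCfg_iterate (closed_codeSupp c _) (labelIn_init c (f p.1)) p.2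
  rw [← toFinCfg_l_eq_none this.2, this.1]
  simp

/-- The running time of a code which always halts is computable. -/
theorem computable_runtime (c : ToPartrec.Code) {α : Type} [Primcodable α] {f : α → List ℕ}
    (hf : Computable f) (h : ∀ a, ∃ n, (next^[n] (init c (f a))).l = none) :
    Computable fun a => runtime (init c (f a)) := by
  classical
  refine (Computable.find (P := fun a n => (next^[n] (init c (f a))).l = none)
    (computablePred_halted c hf) h).of_eq fun a => ?_
  exact le_antisymm (Nat.find_min' _ (iterate_runtime_l (h a))) (runtime_le (Nat.find_spec (h a)))

end Turing.PartrecToTM2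

/-! ### The deciding machine and its simulation of the universal machine. -/

namespace Turing.PartrecToTM2
open TM2.Stmt Function

/-- The machine with step function `f` gets from `a` to `b` in at most `n` steps. -/
def Within {σ : Type} (f : σ → Option σ) (n : ℕ) (a b : σ) : Prop :=
  ∃ k ≤ n, (flip bind f)^[k] (some a) = some b

namespace Within

variable {σ : Type} {f : σ → Option σ} {m n : ℕ} {a b c : σ}

theorem refl (f : σ → Option σ) (n : ℕ) (a : σ) : Within f n a a := ⟨0, Nat.zero_le _, rfl⟩

theorem trans (h₁ : Within f m a b) (h₂ : Within f n b c) : Within f (m + n) a c := by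
  obtain ⟨k, hk, h₁⟩ := h₁
  obtain ⟨l, hl, h₂⟩ := h₂
  exact ⟨l + k, by omega, by rw [iterate_add_apply, h₁, h₂]⟩

theorem mono (h : Within f m a b) (hmn : m ≤ n) : Within f n a b := by
  obtain ⟨k, hk, h⟩ := h
  exact ⟨k, hk.trans hmn, h⟩

theorem single (h : f a = some b) : Within f 1 a b := ⟨1, le_rfl, h⟩

theorem head (h : f a = some b) (h' : Within f n b c) : Within f (n + 1) a c :=
  ((single h).trans h').mono (by omega)

end Within

instance : Fintype K' := ⟨{.main, .rev, .aux, .stack}, fun k => by cases k <;> simp⟩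

/-- The stacks of the deciding machine. -/
inductive Stk
  | inp | out | w (b : Bool) | z (b : Bool) | u | clk | lim | sim (k : K')
  deriving DecidableEq, Fintype

/-- The alphabets of the stacks of the deciding machine. -/
abbrev Alph : Stk → Type
  | .inp => Bool ⊕ Bool
  | .out => Bool
  | .w _ => Γ'
  | .z _ => Γ'
  | .u => Γ'
  | .clk => Γ'
  | .lim => Γ'
  | .sim _ => Γ'

/-- The internal states of the deciding machine. -/
structure Reg where
  s : Option Γ'
  g : Option (Bool ⊕ Bool)
  f : Bool
  deriving Fintype

/-- The initial internal state. -/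
def Reg.init : Reg := ⟨none, none, false⟩

/-- The symbol for a bit. -/
def bit (b : Bool) : Γ' := cond b .bit1 .bit0

/-- The labels of the deciding machine. -/
inductive Lab (S : Finset Λ')
  | split
  | strip (b : Bool)
  | copy (b : Bool)
  | back (b : Bool)
  | run (p : Option Bool) (l : {l // l ∈ S})
  | ret (p : Option Bool) (ok : Bool)
  | clean (b e : Bool)
  | load (b e : Bool)
  | fin (a : Bool)
  deriving Fintype

/-- The contents of all stacks. -/
structure Mem where
  inp : List (Bool ⊕ Bool)
  out : List Bool
  w : Bool → List Γ'
  z : Bool → List Γ'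
  u : List Γ'
  clk : List Γ'
  lim : List Γ'
  sim : K' → List Γ'

/-- The stack contents as a function. -/
def Mem.fn (T : Mem) : ∀ k, List (Alph k)
  | .inp => T.inp
  | .out => T.out
  | .w b => T.w b
  | .z b => T.z b
  | .u => T.u
  | .clk => T.clk
  | .lim => T.lim
  | .sim k => T.sim k

namespace Mem

variable (T : Mem)

@[simp] theorem fn_inp : T.fn .inp = T.inp := rfl
@[simp] theorem fn_out : T.fn .out = T.out := rfl
@[simp] theorem fn_w (b : Bool) : T.fn (.w b) = T.w b := rfl
@[simp] theorem fn_z (b : Bool) : T.fn (.z b) = T.z b := rfl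
@[simp] theorem fn_u : T.fn .u = T.u := rfl
@[simp] theorem fn_clk : T.fn .clk = T.clk := rfl
@[simp] theorem fn_lim : T.fn .lim = T.lim := rfl
@[simp] theorem fn_sim (k : K') : T.fn (.sim k) = T.sim k := rfl

@[simp] theorem update_inp (L) : update T.fn .inp L = { T with inp := L }.fn := by
  funext k; cases k <;> simp
@[simp] theorem update_out (L) : update T.fn .out L = { T with out := L }.fn := by
  funext k; cases k <;> simp
@[simp] theorem update_w (b L) : update T.fn (.w b) L = { T with w := update T.w b L }.fn := by
  funext k
  rcases k with _ | _ | c | _ | _ | _ | _ | _ <;> try simp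
  by_cases h : c = b
  · subst h; simp
  · simp [h]
@[simp] theorem update_z (b L) : update T.fn (.z b) L = { T with z := update T.z b L }.fn := by
  funext k
  rcases k with _ | _ | _ | c | _ | _ | _ | _ <;> try simp
  by_cases h : c = b
  · subst h; simp
  · simp [h]
@[simp] theorem update_u (L) : update T.fn .u L = { T with u := L }.fn := by
  funext k; cases k <;> simp
@[simp] theorem update_clk (L) : update T.fn .clk L = { T with clk := L }.fn := by
  funext k; cases k <;> simp
@[simp] theorem update_lim (L) : update T.fn .lim L = { T with lim := L }.fn := by
  funext k; cases k <;> simp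
@[simp] theorem update_sim (k L) :
    update T.fn (.sim k) L = { T with sim := update T.sim k L }.fn := by
  funext k'
  rcases k' with _ | _ | _ | _ | _ | _ | _ | c <;> try simp
  by_cases h : c = k
  · subst h; simp
  · simp [h]

end Mem

/-- The statements of the deciding machine. -/
abbrev St (S : Finset Λ') : Type := TM2.Stmt Alph (Lab S) Reg

/-- The simulation of a statement of the universal machine. -/
def lift {S : Finset Λ'} (p : Option Bool) : Stmt' → St S
  | .push k f q => .push (.sim k) (fun v => f v.s) (lift p q)
  | .peek k f q => .peek (.sim k) (fun v o => { v with s := f v.s o }) (lift p q)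
  | .pop k f q => .pop (.sim k) (fun v o => { v with s := f v.s o }) (lift p q)
  | .load f q => .load (fun v => { v with s := f v.s }) (lift p q)
  | .branch f q₁ q₂ => .branch (fun v => f v.s) (lift p q₁) (lift p q₂)
  -- The second alternative is a default, never reached from a label in a closed `S`. As `toLab`
  -- uses the same default, `stepAux_lift` needs no closedness.
  | .goto f => .goto fun v => if h : f v.s ∈ S then .run p ⟨_, h⟩ else .ret p true
  | .halt => .goto fun _ => .ret p true

/-- Pop all stacks in a list, and record whether any of them was nonempty. -/
def popAll {S : Finset Λ'} : List Stk → St S → St S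
  | [], q => q
  | k :: ks, q => .pop k (fun v o => { v with f := v.f || o.isSome }) (popAll ks q)

/-- Store the popped symbol. -/
def put (v : Reg) (o : Option Γ') : Reg := { v with s := o }

/-- The stored symbol. -/
def got (v : Reg) : Γ' := v.s.getD .cons

/-- The stacks to be cleared after a simulation. -/
def cleanList (b e : Bool) : List Stk :=
  [.sim .main, .sim .rev, .sim .aux, .sim .stack, .clk] ++ cond e [.z b] []

/-- The stacks to be cleared at the end. -/
def finList : List Stk :=
  [.sim .main, .sim .rev, .sim .aux, .sim .stack, .lim]

/-- The program of the deciding machine. The two input strings are reversed onto the stacks `w b`,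
their trailing zeros are moved to `z b`, the first program of the universal machine is run on the
remaining number for as many steps as there are zeros, and the result is recorded in `z b`. Then the
second program is run on the resulting four numbers for as many steps as there are input symbols. -/
def prog {S : Finset Λ'} (l₁ l₂ : {l // l ∈ S}) : Lab S → St S
  | .split =>
    pop .inp (fun v o => { v with g := o }) <|
      branch (fun v => v.g.isSome)
        -- One unit of clock for the final simulation per input symbol.
        (push .lim (fun _ => Γ'.cons) <|
          branch (fun v => v.g.elim false Sum.isLeft)
            (push (.w false) (fun v => bit (v.g.elim false (Sum.elim id id))) <|
              goto fun _ => .split)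
            (push (.w true) (fun v => bit (v.g.elim false (Sum.elim id id))) <|
              goto fun _ => .split))
        (goto fun _ => .strip false)
  | .strip b =>
    pop (.w b) put <|
      branch (fun v => v.s = some .bit0)
        (push (.z b) (fun _ => Γ'.bit0) <| push .clk (fun _ => Γ'.bit0) <|
          goto fun _ => .strip b)
        -- Stacks are filled from the bottom, so the separator that terminates the number goes in
        -- before its digits.
        (push (.sim .main) (fun _ => Γ'.cons) <|
          branch (fun v => v.s.isSome)
            (push (.w b) got <| goto fun _ => .copy b)
            (goto fun _ => .copy b))
  | .copy b =>
    pop (.w b) put <|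
      branch (fun v => v.s.isSome)
        (push (.sim .main) got <| push .u got <| goto fun _ => .copy b)
        (goto fun _ => .back b)
  | .back b =>
    pop .u put <|
      branch (fun v => v.s.isSome)
        (push (.w b) got <| goto fun _ => .back b)
        (goto fun _ => .run (some b) l₁)
  | .run (some b) l =>
    pop .clk (fun v o => { v with f := o.isSome }) <|
      branch (fun v => v.f) (lift (some b) (tr l)) (goto fun _ => .ret (some b) false)
  | .run none l =>
    pop .lim (fun v o => { v with f := o.isSome }) <|
      branch (fun v => v.f) (lift none (tr l)) (goto fun _ => .ret none false)
  | .ret (some b) true =>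
    pop .clk put <|
      branch (fun v => v.s.isSome)
        -- The program halted with clock to spare, so there are more than `τ` zeros: turning one of
        -- them into a leading one yields `2 ^ (t - 1)`. With an exactly exhausted clock, `z b` is
        -- emptied instead, giving `0`; on a timeout a one is added, giving `2 ^ t`.
        (pop (.z b) (fun v _ => v) <| push (.z b) (fun _ => Γ'.bit1) <|
          goto fun _ => .clean b false)
        (goto fun _ => .clean b true)
  | .ret (some b) false => push (.z b) (fun _ => Γ'.bit1) <| goto fun _ => .clean b false
  | .ret none true => pop (.sim .main) put <| goto fun v => .fin (v.s = some .bit1)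
  | .ret none false => goto fun _ => .fin false
  | .clean b e =>
    -- Each pass pops every listed stack once; the passes stop when one finds them all empty, so the
    -- cost is governed by the longest stack.
    load (fun v => { v with f := false }) <| popAll (cleanList b e) <|
      branch (fun v => v.f) (goto fun _ => .clean b e) <|
        branch (fun _ => b)
          (push (.sim .main) (fun _ => Γ'.cons) <| goto fun _ => .load true false)
          (goto fun _ => .strip true)
  | .load b false =>
    pop (.z b) put <|
      branch (fun v => v.s.isSome)
        (push (.sim .main) got <| goto fun _ => .load b false)
        (push (.sim .main) (fun _ => Γ'.cons) <| goto fun _ => .load b true)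
  | .load b true =>
    pop (.w b) put <|
      branch (fun v => v.s.isSome)
        (push (.sim .main) got <| goto fun _ => .load b true) <|
        branch (fun _ => b)
          (push (.sim .main) (fun _ => Γ'.cons) <| goto fun _ => .load false false)
          (goto fun _ => .run none l₂)
  | .fin a =>
    load (fun v => { v with f := false }) <| popAll finList <|
      branch (fun v => v.f) (goto fun _ => .fin a) <|
        push .out (fun _ => a) <| load (fun _ => Reg.init) TM2.Stmt.halt

/-- The deciding machine. -/
def machine {S : Finset Λ'} (l₁ l₂ : {l // l ∈ S}) : FinTM2 where
  K := Stk
  k₀ := .inp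
  k₁ := .out
  Γ := Alph
  Λ := Lab S
  main := .split
  σ := Reg
  initialState := Reg.init
  Γk₀Fin := inferInstanceAs (Fintype (Bool ⊕ Bool))
  m := prog l₁ l₂

section
variable {S : Finset Λ'} {l₁ l₂ : {l // l ∈ S}}
variable {inp : List (Bool ⊕ Bool)} {out : List Bool} {w z : Bool → List Γ'}
  {u clk lim : List Γ'} {sim : K' → List Γ'} {v : Reg}

variable (l₁ l₂) in
/-- Reachability for the deciding machine. -/
abbrev Go (n : ℕ) (l : Lab S) (v : Reg) (T : Mem) (l' : Lab S) (v' : Reg) (T' : Mem) : Prop :=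
  Within (TM2.step (prog l₁ l₂)) n ⟨some l, v, T.fn⟩ ⟨some l', v', T'.fn⟩

theorem go_split_left (x : List Bool) : ∃ v',
    Go l₁ l₂ x.length .split v ⟨x.map .inl ++ inp, out, w, z, u, clk, lim, sim⟩ .split v'
      ⟨inp, out, update w false ((x.map bit).reverse ++ w false), z, u, clk,
        List.replicate x.length .cons ++ lim, sim⟩ := by
  induction x generalizing v w lim with
  | nil => exact ⟨v, by simpa using Within.refl _ 0 _⟩
  | cons a x ih =>
    have hs : TM2.step (prog l₁ l₂)
        ⟨some .split, v, Mem.fn ⟨(a :: x).map .inl ++ inp, out, w, z, u, clk, lim, sim⟩⟩ =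
        some ⟨some .split, { v with g := some (.inl a) },
          Mem.fn ⟨x.map .inl ++ inp, out, update w false (bit a :: w false), z, u, clk,
            .cons :: lim, sim⟩⟩ := by
      simp [prog]
    obtain ⟨v', h⟩ := ih (v := { v with g := some (.inl a) })
      (w := update w false (bit a :: w false)) (lim := .cons :: lim)
    refine ⟨v', ?_⟩
    have := Within.head hs h
    simpa [List.replicate_succ', List.append_assoc] using this

theorem go_split_right (x : List Bool) : ∃ v',
    Go l₁ l₂ (x.length + 1) .split v ⟨x.map .inr, out, w, z, u, clk, lim, sim⟩ (.strip false) v'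
      ⟨[], out, update w true ((x.map bit).reverse ++ w true), z, u, clk,
        List.replicate x.length .cons ++ lim, sim⟩ := by
  induction x generalizing v w lim with
  | nil =>
    refine ⟨{ v with g := none }, Within.single ?_⟩
    simp [prog]
  | cons a x ih =>
    have hs : TM2.step (prog l₁ l₂)
        ⟨some .split, v, Mem.fn ⟨(a :: x).map .inr, out, w, z, u, clk, lim, sim⟩⟩ =
        some ⟨some .split, { v with g := some (.inr a) },
          Mem.fn ⟨x.map .inr, out, update w true (bit a :: w true), z, u, clk,
            .cons :: lim, sim⟩⟩ := by
      simp [prog]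
    obtain ⟨v', h⟩ := ih (v := { v with g := some (.inr a) })
      (w := update w true (bit a :: w true)) (lim := .cons :: lim)
    refine ⟨v', ?_⟩
    have := Within.head hs h
    simpa [List.replicate_succ', List.append_assoc] using this

/-- `hr` makes the loop stop after exactly `t` zeros. The zeros are copied twice: as a clock for
`c₁`, and as raw material for the digits of `zeroArg`. -/
theorem go_strip (b : Bool) (t : ℕ) {r : List Γ'} (hr : r.head? = none ∨ r.head? = some .bit1) :
    ∃ v', Go l₁ l₂ (t + 1) (.strip b) v
      ⟨inp, out, update w b (List.replicate t .bit0 ++ r), z, u, clk, lim, sim⟩ (.copy b) v'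
      ⟨inp, out, update w b r, update z b (List.replicate t .bit0 ++ z b), u,
        List.replicate t .bit0 ++ clk, lim, update sim .main (.cons :: sim .main)⟩ := by
  induction t generalizing v z clk with
  | zero =>
    refine ⟨{ v with s := r.head? }, Within.single ?_⟩
    rcases r with _ | ⟨a, r⟩
    · simp [prog, put, got]
    · obtain rfl : a = .bit1 := by simpa using hr
      simp [prog, put, got]
  | succ t ih =>
    have hs : TM2.step (prog l₁ l₂) ⟨some (.strip b), v,
          Mem.fn ⟨inp, out, update w b (List.replicate (t + 1) .bit0 ++ r), z, u, clk, lim, sim⟩⟩ =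
        some ⟨some (.strip b), { v with s := some .bit0 },
          Mem.fn ⟨inp, out, update w b (List.replicate t .bit0 ++ r),
            update z b (.bit0 :: z b), u, .bit0 :: clk, lim, sim⟩⟩ := by
      simp [prog, put, List.replicate_succ]
    obtain ⟨v', h⟩ := ih (v := { v with s := some .bit0 }) (z := update z b (.bit0 :: z b))
      (clk := .bit0 :: clk)
    refine ⟨v', ?_⟩
    have := Within.head hs h
    simpa [List.replicate_succ', List.append_assoc] using this

theorem go_copy (b : Bool) (r : List Γ') : ∃ v', Go l₁ l₂ (r.length + 1) (.copy b) v
      ⟨inp, out, update w b r, z, u, clk, lim, sim⟩ (.back b) v'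
      ⟨inp, out, update w b [], z, r.reverse ++ u, clk, lim,
        update sim .main (r.reverse ++ sim .main)⟩ := by
  induction r generalizing v u sim with
  | nil =>
    refine ⟨{ v with s := none }, Within.single ?_⟩
    simp [prog, put, got]
  | cons a r ih =>
    have hs : TM2.step (prog l₁ l₂) ⟨some (.copy b), v,
          Mem.fn ⟨inp, out, update w b (a :: r), z, u, clk, lim, sim⟩⟩ =
        some ⟨some (.copy b), { v with s := some a },
          Mem.fn ⟨inp, out, update w b r, z, a :: u, clk, lim,
            update sim .main (a :: sim .main)⟩⟩ := by
      simp [prog, put, got]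
    obtain ⟨v', h⟩ := ih (v := { v with s := some a }) (u := a :: u)
      (sim := update sim .main (a :: sim .main))
    refine ⟨v', ?_⟩
    have := Within.head hs h
    simpa [List.append_assoc] using this

theorem go_back (b : Bool) (r : List Γ') : ∃ v', v'.s = none ∧ Go l₁ l₂ (r.length + 1) (.back b) v
      ⟨inp, out, w, z, r, clk, lim, sim⟩ (.run (some b) l₁) v'
      ⟨inp, out, update w b (r.reverse ++ w b), z, [], clk, lim, sim⟩ := by
  induction r generalizing v w with
  | nil =>
    refine ⟨{ v with s := none }, rfl, Within.single ?_⟩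
    simp [prog, put, got]
  | cons a r ih =>
    have hs : TM2.step (prog l₁ l₂) ⟨some (.back b), v,
          Mem.fn ⟨inp, out, w, z, a :: r, clk, lim, sim⟩⟩ =
        some ⟨some (.back b), { v with s := some a },
          Mem.fn ⟨inp, out, update w b (a :: w b), z, r, clk, lim, sim⟩⟩ := by
      simp [prog, put, got]
    obtain ⟨v', hv, h⟩ := ih (v := { v with s := some a }) (w := update w b (a :: w b))
    refine ⟨v', hv, ?_⟩
    have := Within.head hs h
    simpa [List.append_assoc] using this

theorem go_load_z (b : Bool) (r : List Γ') : ∃ v', Go l₁ l₂ (r.length + 1) (.load b false) v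
      ⟨inp, out, w, update z b r, u, clk, lim, sim⟩ (.load b true) v'
      ⟨inp, out, w, update z b [], u, clk, lim,
        update sim .main (.cons :: r.reverse ++ sim .main)⟩ := by
  induction r generalizing v sim with
  | nil =>
    refine ⟨{ v with s := none }, Within.single ?_⟩
    simp [prog, put, got]
  | cons a r ih =>
    have hs : TM2.step (prog l₁ l₂) ⟨some (.load b false), v,
          Mem.fn ⟨inp, out, w, update z b (a :: r), u, clk, lim, sim⟩⟩ =
        some ⟨some (.load b false), { v with s := some a },
          Mem.fn ⟨inp, out, w, update z b r, u, clk, lim,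
            update sim .main (a :: sim .main)⟩⟩ := by
      simp [prog, put, got]
    obtain ⟨v', h⟩ := ih (v := { v with s := some a })
      (sim := update sim .main (a :: sim .main))
    refine ⟨v', ?_⟩
    have := Within.head hs h
    simpa [List.append_assoc] using this

theorem go_load_w_true (r : List Γ') : ∃ v', Go l₁ l₂ (r.length + 1) (.load true true) v
      ⟨inp, out, update w true r, z, u, clk, lim, sim⟩ (.load false false) v'
      ⟨inp, out, update w true [], z, u, clk, lim,
        update sim .main (.cons :: r.reverse ++ sim .main)⟩ := by
  induction r generalizing v sim with
  | nil =>
    refine ⟨{ v with s := none }, Within.single ?_⟩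
    simp [prog, put, got]
  | cons a r ih =>
    have hs : TM2.step (prog l₁ l₂) ⟨some (.load true true), v,
          Mem.fn ⟨inp, out, update w true (a :: r), z, u, clk, lim, sim⟩⟩ =
        some ⟨some (.load true true), { v with s := some a },
          Mem.fn ⟨inp, out, update w true r, z, u, clk, lim,
            update sim .main (a :: sim .main)⟩⟩ := by
      simp [prog, put, got]
    obtain ⟨v', h⟩ := ih (v := { v with s := some a })
      (sim := update sim .main (a :: sim .main))
    refine ⟨v', ?_⟩
    have := Within.head hs h
    simpa [List.append_assoc] using this

theorem go_load_w_false (r : List Γ') : ∃ v', v'.s = none ∧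
    Go l₁ l₂ (r.length + 1) (.load false true) v
      ⟨inp, out, update w false r, z, u, clk, lim, sim⟩ (.run none l₂) v'
      ⟨inp, out, update w false [], z, u, clk, lim,
        update sim .main (r.reverse ++ sim .main)⟩ := by
  induction r generalizing v sim with
  | nil =>
    refine ⟨{ v with s := none }, rfl, Within.single ?_⟩
    simp [prog, put, got]
  | cons a r ih =>
    have hs : TM2.step (prog l₁ l₂) ⟨some (.load false true), v,
          Mem.fn ⟨inp, out, update w false (a :: r), z, u, clk, lim, sim⟩⟩ =
        some ⟨some (.load false true), { v with s := some a },
          Mem.fn ⟨inp, out, update w false r, z, u, clk, lim,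
            update sim .main (a :: sim .main)⟩⟩ := by
      simp [prog, put, got]
    obtain ⟨v', hv, h⟩ := ih (v := { v with s := some a })
      (sim := update sim .main (a :: sim .main))
    refine ⟨v', hv, ?_⟩
    have := Within.head hs h
    simpa [List.append_assoc] using this

end
theorem stepAux_popAll {S : Finset Λ'} {ks : List Stk} (hks : ks.Nodup) (q : St S) (v : Reg)
    (T : ∀ k, List (Alph k)) :
    TM2.stepAux (popAll ks q) v T =
      TM2.stepAux q { v with f := v.f || ks.any fun k => !(T k).isEmpty }
        (fun k => if k ∈ ks then (T k).tail else T k) := by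
  induction ks generalizing v T with
  | nil => simp [popAll]
  | cons k ks ih =>
    obtain ⟨hk, hks⟩ := List.nodup_cons.1 hks
    rw [popAll, TM2.stepAux, ih hks]
    congr 1
    · have h₁ : (ks.any fun k' => !(update T k (T k).tail k').isEmpty) =
          ks.any fun k' => !(T k').isEmpty := by
        rw [Bool.eq_iff_iff, List.any_eq_true, List.any_eq_true]
        refine exists_congr fun k' => and_congr_right fun hk' => ?_
        rw [update_of_ne (show k' ≠ k by rintro rfl; exact hk hk')]
      have h₂ : (T k).head?.isSome = !(T k).isEmpty := by cases T k <;> rfl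
      simp only [h₁, h₂, List.any_cons, Bool.or_assoc]
    · funext k'
      by_cases h : k' = k
      · subst h; simp [hk]
      · simp [h]

section
variable {S : Finset Λ'} {l₁ l₂ : {l // l ∈ S}}
variable {inp : List (Bool ⊕ Bool)} {out : List Bool} {w z : Bool → List Γ'}
  {u clk lim : List Γ'} {sim : K' → List Γ'} {v : Reg}

theorem fn_tail_clean (b e : Bool) :
    (fun k => if k ∈ cleanList b e then (Mem.fn ⟨inp, out, w, z, u, clk, lim, sim⟩ k).tail
      else Mem.fn ⟨inp, out, w, z, u, clk, lim, sim⟩ k) =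
    Mem.fn ⟨inp, out, w, cond e (update z b (z b).tail) z, u, clk.tail, lim,
      fun k => (sim k).tail⟩ := by
  funext k
  rcases k with _ | _ | _ | c | _ | _ | _ | k
  case sim => cases k <;> simp [cleanList]
  case z =>
    cases e
    · simp [cleanList]
    · by_cases h : c = b
      · subst h; simp [cleanList]
      · simp [cleanList, h]
  all_goals cases e <;> simp [cleanList]

theorem go_clean (b e : Bool) (n : ℕ) (h₁ : ∀ k, (sim k).length ≤ n) (h₂ : clk.length ≤ n)
    (h₃ : e = true → (z b).length ≤ n) :
    ∃ v', Go l₁ l₂ (n + 1) (.clean b e) v ⟨inp, out, w, z, u, clk, lim, sim⟩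
      (cond b (.load true false) (.strip true)) v'
      ⟨inp, out, w, cond e (update z b []) z, u, [], lim,
        cond b (update (fun _ => []) .main [.cons]) fun _ => []⟩ := by
  have hnd : (cleanList b e).Nodup := by cases e <;> simp [cleanList]
  induction n generalizing v z clk sim with
  | zero =>
    refine ⟨{ v with f := false }, Within.single ?_⟩
    obtain rfl : sim = fun _ => [] := by
      funext k
      exact List.eq_nil_of_length_eq_zero (Nat.le_zero.1 (h₁ k))
    obtain rfl := List.eq_nil_of_length_eq_zero (Nat.le_zero.1 h₂)
    have hz : e = true → z b = [] :=
      fun h => List.eq_nil_of_length_eq_zero (Nat.le_zero.1 (h₃ h))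
    cases e
    · cases b <;> simp [prog, stepAux_popAll hnd, fn_tail_clean] <;> simp [cleanList]
    · cases b <;> simp [prog, stepAux_popAll hnd, fn_tail_clean, hz rfl] <;>
        simp [cleanList, hz rfl]
  | succ n ih =>
    by_cases hf : ((cleanList b e).any fun k =>
      !(Mem.fn ⟨inp, out, w, z, u, clk, lim, sim⟩ k).isEmpty) = true
    · have hs : TM2.step (prog l₁ l₂) ⟨some (.clean b e), v,
          Mem.fn ⟨inp, out, w, z, u, clk, lim, sim⟩⟩ =
        some ⟨some (.clean b e), { v with f := true },
          Mem.fn ⟨inp, out, w, cond e (update z b (z b).tail) z, u, clk.tail, lim,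
            fun k => (sim k).tail⟩⟩ := by
        simp [prog, stepAux_popAll hnd, fn_tail_clean, hf]
      obtain ⟨v', h⟩ := ih (v := { v with f := true })
        (z := cond e (update z b (z b).tail) z) (clk := clk.tail)
        (sim := fun k => (sim k).tail) (fun k => by simpa using h₁ k)
        (by simpa using h₂) (fun he => by subst he; simpa using h₃ rfl)
      refine ⟨v', ?_⟩
      have := Within.head hs h
      cases e <;> simpa using this
    -- All stacks are already empty, so the smaller bound holds as well and the induction hypothesis
    -- applies without taking a step.
    · have hs' : (∀ k, (sim k).length ≤ n) ∧ clk.length ≤ n ∧ (e = true → (z b).length ≤ n) := by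
        have : ∀ k ∈ cleanList b e, Mem.fn ⟨inp, out, w, z, u, clk, lim, sim⟩ k = [] := by
          intro k hk
          by_contra hne
          exact hf (List.any_eq_true.2 ⟨k, hk, by simpa using hne⟩)
        refine ⟨fun k => ?_, ?_, fun he => ?_⟩
        · have := this (.sim k) (by cases k <;> simp [cleanList])
          simp only [Mem.fn_sim] at this
          simp [this]
        · have := this .clk (by simp [cleanList])
          simp only [Mem.fn_clk] at this
          simp [this]
        · have := this (.z b) (by simp [cleanList, he])
          simp only [Mem.fn_z] at this
          simp [this]
      obtain ⟨v', h⟩ := ih hs'.1 hs'.2.1 hs'.2.2 (v := v)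
      exact ⟨v', h.mono (Nat.le_succ _)⟩

theorem fn_tail_fin :
    (fun k => if k ∈ finList then (Mem.fn ⟨inp, out, w, z, u, clk, lim, sim⟩ k).tail
      else Mem.fn ⟨inp, out, w, z, u, clk, lim, sim⟩ k) =
    Mem.fn ⟨inp, out, w, z, u, clk, lim.tail, fun k => (sim k).tail⟩ := by
  funext k
  rcases k with _ | _ | _ | _ | _ | _ | _ | k
  case sim => cases k <;> simp [finList]
  all_goals simp [finList]

theorem within_fin (a : Bool) (n : ℕ) (h₁ : ∀ k, (sim k).length ≤ n) (h₂ : lim.length ≤ n) :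
    Within (TM2.step (prog l₁ l₂)) (n + 1)
      ⟨some (.fin a), v, Mem.fn ⟨[], [], w, z, u, clk, lim, sim⟩⟩
      ⟨none, Reg.init, Mem.fn ⟨[], [a], w, z, u, clk, [], fun _ => []⟩⟩ := by
  have hnd : finList.Nodup := by simp [finList]
  induction n generalizing v lim sim with
  | zero =>
    refine Within.single ?_
    obtain rfl : sim = fun _ => [] := by
      funext k
      exact List.eq_nil_of_length_eq_zero (Nat.le_zero.1 (h₁ k))
    obtain rfl := List.eq_nil_of_length_eq_zero (Nat.le_zero.1 h₂)
    simp [prog, stepAux_popAll hnd, fn_tail_fin]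
    simp [finList]
  | succ n ih =>
    by_cases hf : (finList.any fun k =>
      !(Mem.fn ⟨[], [], w, z, u, clk, lim, sim⟩ k).isEmpty) = true
    · have hs : TM2.step (prog l₁ l₂) ⟨some (.fin a), v,
          Mem.fn ⟨[], [], w, z, u, clk, lim, sim⟩⟩ =
        some ⟨some (.fin a), { v with f := true },
          Mem.fn ⟨[], [], w, z, u, clk, lim.tail, fun k => (sim k).tail⟩⟩ := by
        simp [prog, stepAux_popAll hnd, fn_tail_fin, hf]
      exact Within.head hs (ih (fun k => by simpa using h₁ k) (by simpa using h₂))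
    · have hs' : (∀ k, (sim k).length ≤ n) ∧ lim.length ≤ n := by
        have : ∀ k ∈ finList, Mem.fn ⟨[], [], w, z, u, clk, lim, sim⟩ k = [] := by
          intro k hk
          by_contra hne
          exact hf (List.any_eq_true.2 ⟨k, hk, by simpa using hne⟩)
        refine ⟨fun k => ?_, ?_⟩
        · have := this (.sim k) (by cases k <;> simp [finList])
          simp only [Mem.fn_sim] at this
          simp [this]
        · have := this .lim (by simp [finList])
          simp only [Mem.fn_lim] at this
          simp [this]
      exact (ih hs'.1 hs'.2).mono (Nat.le_succ _)

/-- The label of the deciding machine that corresponds to a label of the universal machine. -/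
noncomputable def toLab (S : Finset Λ') (p : Option Bool) (l : Option Λ') : Lab S :=
  l.elim (.ret p true) fun l => if h : l ∈ S then .run p ⟨l, h⟩ else .ret p true

theorem stepAux_lift (p : Option Bool) (q : Stmt') (v : Reg) (T : Mem) :
    ∃ v', v'.s = (TM2.stepAux q v.s T.sim).var ∧
      TM2.stepAux (lift p q) v T.fn = (⟨some (toLab S p (TM2.stepAux q v.s T.sim).l), v',
        Mem.fn { T with sim := (TM2.stepAux q v.s T.sim).stk }⟩ : TM2.Cfg Alph (Lab S) Reg) := by
  induction q generalizing v T with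
  | push k f q ih =>
    obtain ⟨v', h, h'⟩ := ih v { T with sim := update T.sim k (f v.s :: T.sim k) }
    exact ⟨v', h, by simpa [lift] using h'⟩
  | peek k f q ih =>
    obtain ⟨v', h, h'⟩ := ih { v with s := f v.s (T.sim k).head? } T
    exact ⟨v', h, by simpa [lift] using h'⟩
  | pop k f q ih =>
    obtain ⟨v', h, h'⟩ := ih { v with s := f v.s (T.sim k).head? }
      { T with sim := update T.sim k (T.sim k).tail }
    exact ⟨v', h, by simpa [lift] using h'⟩
  | load f q ih =>
    obtain ⟨v', h, h'⟩ := ih { v with s := f v.s } T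
    exact ⟨v', h, by simpa [lift] using h'⟩
  | branch f q₁ q₂ ih₁ ih₂ =>
    rw [lift, TM2.stepAux, TM2.stepAux]
    cases f v.s
    · exact ih₂ v T
    · exact ih₁ v T
  | goto f => exact ⟨v, rfl, rfl⟩
  | halt => exact ⟨v, rfl, rfl⟩

/-- The memory with prescribed stacks and clock of a simulation. -/
def Mem.set (T : Mem) (p : Option Bool) (L : List Γ') (sim : K' → List Γ') : Mem :=
  p.elim { T with lim := L, sim := sim } fun _ => { T with clk := L, sim := sim }

theorem step_run_nil (p : Option Bool) (l : {l // l ∈ S}) (v : Reg) (T : Mem)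
    (sim : K' → List Γ') :
    TM2.step (prog l₁ l₂) ⟨some (.run p l), v, (T.set p [] sim).fn⟩ =
      some ⟨some (.ret p false), { v with f := false }, (T.set p [] sim).fn⟩ := by
  rcases p with _ | b <;> simp [prog, Mem.set]

/-- One step of the universal machine costs one step here and one clock symbol. -/
theorem step_run_cons (p : Option Bool) {C : Cfg'} {l : Λ'} (hl : C.l = some l) (hS : l ∈ S)
    (v : Reg) (hv : v.s = C.var) (T : Mem) (a : Γ') (L : List Γ') :
    ∃ v', v'.s = (next C).var ∧
    TM2.step (prog l₁ l₂) ⟨some (toLab S p C.l), v, (T.set p (a :: L) C.stk).fn⟩ =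
      some ⟨some (toLab S p (next C).l), v', (T.set p L (next C).stk).fn⟩ := by
  rcases C with ⟨l', s, T'⟩
  obtain rfl : l' = some l := hl
  obtain rfl : v.s = s := hv
  rcases p with _ | b
  · obtain ⟨v', h, h'⟩ := stepAux_lift (S := S) none (tr l) { v with f := true }
      { T with lim := L, sim := T' }
    refine ⟨v', h, ?_⟩
    rw [toLab, Option.elim_some, dif_pos hS]
    simpa [prog, Mem.set, next_some] using h'
  · obtain ⟨v', h, h'⟩ := stepAux_lift (S := S) (some b) (tr l) { v with f := true }
      { T with clk := L, sim := T' }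
    refine ⟨v', h, ?_⟩
    rw [toLab, Option.elim_some, dif_pos hS]
    simpa [prog, Mem.set, next_some] using h'

/-- A jump to a halted configuration goes directly to `.ret p true` without consulting the clock, so
a clock of length exactly `k` suffices. This is what lets the machine detect `t = τ`. -/
theorem go_run_halt (hS : Closed S) (p : Option Bool) (k : ℕ) (T : Mem) {C : Cfg'}
    (hC : LabelIn S C) {v : Reg} (hv : v.s = C.var) {L : List Γ'}
    (hk : (next^[k] C).l = none) (hk' : ∀ j < k, (next^[j] C).l ≠ none) (hL : k ≤ L.length) :
    ∃ v', Go l₁ l₂ k (toLab S p C.l) v (T.set p L C.stk) (.ret p true) v'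
      (T.set p (L.drop k) (next^[k] C).stk) := by
  induction k generalizing C v L with
  | zero =>
    have hk₀ : C.l = none := hk
    refine ⟨v, ?_⟩
    rw [hk₀]
    exact Within.refl _ _ _
  | succ k ih =>
    obtain ⟨l, hl⟩ := Option.ne_none_iff_exists'.1 (hk' 0 (Nat.succ_pos k))
    rcases L with _ | ⟨a, L⟩
    · simp at hL
    obtain ⟨v₁, hv₁, hs⟩ := step_run_cons (l₁ := l₁) (l₂ := l₂) p hl (hC l hl) v hv T a L
    obtain ⟨v', h⟩ := ih (hC.next hS) hv₁ hk (fun j hj => hk' (j + 1) (Nat.succ_lt_succ hj))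
      (L := L) (by simpa using hL)
    exact ⟨v', Within.head hs h⟩

theorem go_run_timeout (hS : Closed S) (p : Option Bool) (T : Mem) {C : Cfg'}
    (hC : LabelIn S C) {v : Reg} (hv : v.s = C.var) {L : List Γ'}
    (hk : ∀ j ≤ L.length, (next^[j] C).l ≠ none) :
    ∃ v', Go l₁ l₂ (L.length + 1) (toLab S p C.l) v (T.set p L C.stk) (.ret p false) v'
      (T.set p [] (next^[L.length] C).stk) := by
  induction L generalizing C v with
  | nil =>
    obtain ⟨l, hl⟩ := Option.ne_none_iff_exists'.1 (hk 0 le_rfl)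
    refine ⟨{ v with f := false }, Within.single ?_⟩
    have hl' : C.l = some l := hl
    rw [hl', toLab, Option.elim_some, dif_pos (hC l hl')]
    exact step_run_nil p _ v T _
  | cons a L ih =>
    obtain ⟨l, hl⟩ := Option.ne_none_iff_exists'.1 (hk 0 (Nat.zero_le _))
    obtain ⟨v₁, hv₁, hs⟩ := step_run_cons (l₁ := l₁) (l₂ := l₂) p hl (hC l hl) v hv T a L
    obtain ⟨v', h⟩ := ih (hC.next hS) hv₁ (fun j hj => hk (j + 1) (Nat.succ_le_succ hj))
    exact ⟨v', Within.head hs h⟩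

end
-- Binary strings, their decoding, and the total running time.
theorem trNat_two_pow (t : ℕ) : trNat (2 ^ t) = List.replicate t .bit0 ++ [.bit1] := by
  induction t with
  | zero => rfl
  | succ t ih =>
    rw [trNat_eq, if_neg (by positivity), pow_succ']
    have h₁ : (2 * 2 ^ t).bodd = false := by simp
    have h₂ : (2 * 2 ^ t).div2 = 2 ^ t := by rw [Nat.div2_val]; omega
    simp [h₁, h₂, ih, List.replicate_succ]

theorem head?_reverse_trNat (m : ℕ) :
    (trNat m).reverse.head? = none ∨ (trNat m).reverse.head? = some .bit1 := by
  have h (p : PosNum) : (trPosNum p).reverse.head? = some .bit1 := by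
    induction p with
    | one => rfl
    | bit1 p ih => rw [trPosNum, List.reverse_cons, List.head?_append, ih]; rfl
    | bit0 p ih => rw [trPosNum, List.reverse_cons, List.head?_append, ih]; rfl
  rw [trNat]
  rcases (m : Num) with _ | p
  · exact Or.inl rfl
  · exact Or.inr (h p)

theorem map_bit_encodeNat (m : ℕ) : (Computability.encodeNat m).map bit = trNat m := by
  have h (p : PosNum) : (Computability.encodePosNum p).map bit = trPosNum p := by
    induction p with
    | one => rfl
    | bit1 p ih => simp [trPosNum, Computability.encodePosNum, ih, bit]
    | bit0 p ih => simp [trPosNum, Computability.encodePosNum, ih, bit]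
  rw [trNat, Computability.encodeNat]
  rcases (m : Num) with _ | p
  · rfl
  · exact h p

/-- The number recording how the number `t` of trailing zeros compares with `τ`. -/
def zeroArg (τ t : ℕ) : ℕ := if t = τ then 0 else if t < τ then 2 ^ t else 2 ^ (t - 1)

section
variable {S : Finset Λ'} {c₁ c₂ : ToPartrec.Code} {h₁ : trNormal c₁ Cont'.halt ∈ S}
  {h₂ : trNormal c₂ Cont'.halt ∈ S}
variable {w z : Bool → List Γ'} {lim : List Γ'} {v : Reg}

theorem labelIn_init_of_mem {c : ToPartrec.Code} (h : trNormal c Cont'.halt ∈ S) (L : List ℕ) :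
    LabelIn S (init c L) := by
  rintro l hl
  cases hl
  exact h

theorem toLab_init {c : ToPartrec.Code} (h : trNormal c Cont'.halt ∈ S) (p : Option Bool)
    (L : List ℕ) : toLab S p (init c L).l = .run p ⟨_, h⟩ := by
  simp only [init, toLab, Option.elim_some, dif_pos h]

theorem length_init_le (c : ToPartrec.Code) (L : List ℕ) (k : K') :
    ((init c L).stk k).length ≤ (trList L).length := by
  cases k <;> simp [init]

/-- The cases `t < τ`, `t = τ` and `t > τ` are a timeout, a halt with empty clock, and a halt with
clock left over. The simulation takes at most `t` steps and adds at most two symbols per step to a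
stack, so simulation and clearing together stay linear. -/
theorem go_decode_ret (hS : Closed S) (b : Bool) (t m : ℕ) {v : Reg} (hv : v.s = none)
    (hh : ∃ n, (next^[n] (init c₁ [m])).l = none) :
    ∃ v', Go ⟨_, h₁⟩ ⟨_, h₂⟩ (4 * t + (trNat m).length + 4) (.run (some b) ⟨_, h₁⟩) v
      ⟨[], [], w, update z b (List.replicate t .bit0), [], List.replicate t .bit0, lim,
        update (fun _ => []) .main (trNat m ++ [.cons])⟩
      (cond b (.load true false) (.strip true)) v'
      ⟨[], [], w, update z b (trNat (zeroArg (runtime (init c₁ [m])) t)).reverse, [], [], lim,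
        cond b (update (fun _ => []) .main [.cons]) fun _ => []⟩ := by
  set τ := runtime (init c₁ [m])
  set C := init c₁ [m] with hC
  have hstk : update (fun _ => []) .main (trNat m ++ [.cons]) = C.stk := by
    funext k; cases k <;> simp [hC, init]
  have hlen (k : K') (n : ℕ) (hn : n ≤ t) :
      ((next^[n] C).stk k).length ≤ (trNat m).length + 1 + 2 * t := by
    have h := length_iterate_next_le C k n
    have h' : (C.stk k).length ≤ _ := length_init_le c₁ [m] k
    simp only [trList, List.length_append, List.length_cons, List.length_nil] at h'
    omega
  rw [hstk]
  let T : Mem := ⟨[], [], w, update z b (List.replicate t .bit0), [], [], lim, fun _ => []⟩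
  by_cases htτ : t < τ
  · obtain ⟨v₁, g₁⟩ := go_run_timeout (l₁ := ⟨_, h₁⟩) (l₂ := ⟨_, h₂⟩) hS (some b) T
      (labelIn_init_of_mem h₁ [m]) (v := v) hv (L := List.replicate t .bit0)
      (fun j hj hn => by
        rw [List.length_replicate] at hj
        exact absurd (runtime_le hn) (by omega))
    rw [toLab_init h₁, List.length_replicate] at g₁
    have hs : TM2.step (prog ⟨_, h₁⟩ ⟨_, h₂⟩)
        ⟨some (.ret (some b) false), v₁, (T.set (some b) [] (next^[t] C).stk).fn⟩ =
        some ⟨some (.clean b false), v₁, Mem.fn ⟨[], [], w,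
          update z b (.bit1 :: List.replicate t .bit0), [], [], lim, (next^[t] C).stk⟩⟩ := by
      simp [prog, Mem.set, T]
    obtain ⟨v₂, g₂⟩ := go_clean (l₁ := ⟨_, h₁⟩) (l₂ := ⟨_, h₂⟩) (inp := []) (out := []) (w := w)
      (z := update z b (.bit1 :: List.replicate t .bit0)) (u := []) (clk := []) (lim := lim)
      (sim := (next^[t] C).stk) (v := v₁) b false _
      (fun k => hlen k t le_rfl) (by simp) (by simp)
    refine ⟨v₂, ?_⟩
    have := (g₁.trans (Within.head hs g₂)).mono
      (show _ ≤ 4 * t + (trNat m).length + 4 by omega)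
    have hz : zeroArg τ t = 2 ^ t := by rw [zeroArg, if_neg htτ.ne, if_pos htτ]
    rw [hz, trNat_two_pow]
    simpa [Mem.set, T, C] using this
  · obtain ⟨v₁, g₁⟩ := go_run_halt (l₁ := ⟨_, h₁⟩) (l₂ := ⟨_, h₂⟩) hS (some b) τ T
      (labelIn_init_of_mem h₁ [m]) (v := v) hv (L := List.replicate t .bit0)
      (iterate_runtime_l hh) (fun j hj hn => absurd (runtime_le hn) (by omega))
      (by rw [List.length_replicate]; omega)
    rw [toLab_init h₁, List.drop_replicate] at g₁
    by_cases hte : t = τ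
    · have hs : TM2.step (prog ⟨_, h₁⟩ ⟨_, h₂⟩) ⟨some (.ret (some b) true), v₁,
          (T.set (some b) (List.replicate (t - τ) .bit0) (next^[τ] C).stk).fn⟩ =
          some ⟨some (.clean b true), { v₁ with s := none }, Mem.fn ⟨[], [], w,
            update z b (List.replicate t .bit0), [], [], lim, (next^[τ] C).stk⟩⟩ := by
        simp [prog, Mem.set, T, put, hte]
      obtain ⟨v₂, g₂⟩ := go_clean (l₁ := ⟨_, h₁⟩) (l₂ := ⟨_, h₂⟩) (inp := []) (out := []) (w := w)
        (z := update z b (List.replicate t .bit0)) (u := []) (clk := []) (lim := lim)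
        (sim := (next^[τ] C).stk) (v := { v₁ with s := none }) b true
        ((trNat m).length + 1 + 2 * t)
        (fun k => hlen k τ (by omega)) (by simp) (by simp; omega)
      refine ⟨v₂, ?_⟩
      have := (g₁.trans (Within.head hs g₂)).mono
        (show _ ≤ 4 * t + (trNat m).length + 4 by omega)
      rw [zeroArg, if_pos hte]
      simpa [Mem.set, T, C] using this
    · obtain ⟨t', rfl⟩ : ∃ t', t = t' + 1 := ⟨t - 1, by omega⟩
      obtain ⟨r, hr⟩ : ∃ r, t' + 1 - τ = r + 1 := ⟨t' - τ, by omega⟩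
      have hs : TM2.step (prog ⟨_, h₁⟩ ⟨_, h₂⟩) ⟨some (.ret (some b) true), v₁,
          (T.set (some b) (List.replicate (t' + 1 - τ) .bit0) (next^[τ] C).stk).fn⟩ =
          some ⟨some (.clean b false), { v₁ with s := some .bit0 }, Mem.fn ⟨[], [], w,
            update z b (.bit1 :: List.replicate t' .bit0), [], List.replicate r .bit0, lim,
              (next^[τ] C).stk⟩⟩ := by
        rw [hr]
        simp [prog, Mem.set, T, put, List.replicate_succ]
      obtain ⟨v₂, g₂⟩ := go_clean (l₁ := ⟨_, h₁⟩) (l₂ := ⟨_, h₂⟩) (inp := []) (out := []) (w := w)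
        (z := update z b (.bit1 :: List.replicate t' .bit0)) (u := [])
        (clk := List.replicate r .bit0) (lim := lim)
        (sim := (next^[τ] C).stk) (v := { v₁ with s := some .bit0 }) b false
        ((trNat m).length + 1 + 2 * (t' + 1))
        (fun k => hlen k τ (by omega)) (by simp; omega) (by simp)
      refine ⟨v₂, ?_⟩
      have := (g₁.trans (Within.head hs g₂)).mono
        (show _ ≤ 4 * (t' + 1) + (trNat m).length + 4 by omega)
      have hz : zeroArg τ (t' + 1) = 2 ^ t' := by
        rw [zeroArg, if_neg hte, if_neg htτ, Nat.add_sub_cancel]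
      rw [hz, trNat_two_pow]
      simpa [Mem.set, T, C] using this

theorem go_decode (hS : Closed S) (b : Bool) (t m : ℕ)
    (hh : ∃ n, (next^[n] (init c₁ [m])).l = none) (hz : z b = []) :
    ∃ v', Go ⟨_, h₁⟩ ⟨_, h₂⟩ (5 * (t + (trNat m).length) + 7) (.strip b) v
      ⟨[], [], update w b (List.replicate t .bit0 ++ (trNat m).reverse), z, [], [], lim,
        fun _ => []⟩
      (cond b (.load true false) (.strip true)) v'
      ⟨[], [], update w b (trNat m).reverse,
        update z b (trNat (zeroArg (runtime (init c₁ [m])) t)).reverse, [], [], lim,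
        cond b (update (fun _ => []) .main [.cons]) fun _ => []⟩ := by
  obtain ⟨v₁, g₁⟩ := go_strip (l₁ := ⟨_, h₁⟩) (l₂ := ⟨_, h₂⟩) (inp := []) (out := []) (w := w)
    (z := z) (u := []) (clk := []) (lim := lim) (sim := fun _ => []) (v := v) b t
    (head?_reverse_trNat m)
  obtain ⟨v₂, g₂⟩ := go_copy (l₁ := ⟨_, h₁⟩) (l₂ := ⟨_, h₂⟩) (inp := []) (out := []) (w := w)
    (z := update z b (List.replicate t .bit0)) (u := []) (clk := List.replicate t .bit0)
    (lim := lim) (sim := update (fun _ => []) .main [.cons]) (v := v₁) b (trNat m).reverse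
  obtain ⟨v₃, hv, g₃⟩ := go_back (l₁ := ⟨_, h₁⟩) (l₂ := ⟨_, h₂⟩) (inp := []) (out := [])
    (w := update w b []) (z := update z b (List.replicate t .bit0))
    (clk := List.replicate t .bit0) (lim := lim)
    (sim := update (fun _ => []) .main (trNat m ++ [.cons])) (v := v₂) b (trNat m)
  obtain ⟨v₄, g₄⟩ := go_decode_ret (h₁ := h₁) (h₂ := h₂) (w := update w b (trNat m).reverse)
    (z := z) (lim := lim) hS b t m hv hh
  refine ⟨v₄, ?_⟩
  simp only [hz, List.append_nil] at g₁
  simp only [List.length_reverse, List.reverse_reverse, List.append_nil, update_self,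
    update_idem] at g₂
  simp only [update_self, update_idem, List.append_nil] at g₃
  exact (g₁.trans (g₂.trans (g₃.trans g₄))).mono (by omega)

end
/-- A pair as a function on the booleans. -/
def two (X Y : List Γ') : Bool → List Γ' := fun b => cond b Y X

@[simp] theorem two_false (X Y) : two X Y false = X := rfl
@[simp] theorem two_true (X Y) : two X Y true = Y := rfl
@[simp] theorem update_two_false (X Y Z) : update (two X Y) false Z = two Z Y := by
  funext b; cases b <;> simp
@[simp] theorem update_two_true (X Y Z) : update (two X Y) true Z = two X Z := by
  funext b; cases b <;> simp

/-- The binary string with value `m`, least significant bit first, and `t` trailing zeros. -/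
def str (t m : ℕ) : List Bool := Computability.encodeNat m ++ List.replicate t false

theorem map_bit_str (t m : ℕ) :
    ((str t m).map bit).reverse = List.replicate t .bit0 ++ (trNat m).reverse := by
  simp [str, map_bit_encodeNat, bit]

theorem length_str (t m : ℕ) : (str t m).length = t + (trNat m).length := by
  rw [str, List.length_append, List.length_replicate, ← map_bit_encodeNat, List.length_map,
    add_comm]

theorem str_injective {t m t' m' : ℕ} (h : str t m = str t' m') : t = t' ∧ m = m' := by
  have key : ∀ {t t' : ℕ} {L L' : List Γ'}, L.head? = none ∨ L.head? = some .bit1 →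
      L'.head? = none ∨ L'.head? = some .bit1 →
      List.replicate t Γ'.bit0 ++ L = List.replicate t' .bit0 ++ L' → t = t' ∧ L = L' := by
    intro t
    induction t with
    | zero =>
      rintro (_ | t') L L' hL hL' h
      · exact ⟨rfl, by simpa using h⟩
      · obtain rfl : L = _ := h
        simp [List.replicate_succ] at hL
    | succ t ih =>
      rintro (_ | t') L L' hL hL' h
      · obtain rfl : _ = L' := h
        simp [List.replicate_succ] at hL'
      · rw [List.replicate_succ, List.replicate_succ, List.cons_append, List.cons_append] at h
        obtain ⟨rfl, rfl⟩ := ih hL hL' (List.cons.inj h).2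
        exact ⟨rfl, rfl⟩
  have h' := congrArg (fun x : List Bool => (x.map bit).reverse) h
  simp only [map_bit_str] at h'
  obtain ⟨rfl, -⟩ := key (head?_reverse_trNat m) (head?_reverse_trNat m') h'
  refine ⟨rfl, ?_⟩
  exact Computability.encodingNatBool.encode_injective (List.append_cancel_right h)

/-- Without its trailing zeros a string is empty or ends in a one, hence is the canonical expansion
of a number. -/
theorem exists_eq_str (x : List Bool) : ∃ t m, x = str t m := by
  have h (x : List Bool) : ∃ p, Computability.encodePosNum p = x ++ [true] := by
    induction x with
    | nil => exact ⟨.one, rfl⟩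
    | cons a x ih =>
      obtain ⟨p, hp⟩ := ih
      cases a
      · exact ⟨.bit0 p, by simp [Computability.encodePosNum, hp]⟩
      · exact ⟨.bit1 p, by simp [Computability.encodePosNum, hp]⟩
  induction x using List.reverseRecOn with
  | nil => exact ⟨0, 0, rfl⟩
  | append_singleton x a ih =>
    cases a
    · obtain ⟨t, m, rfl⟩ := ih
      exact ⟨t + 1, m, by simp [str, List.replicate_succ']⟩
    · obtain ⟨p, hp⟩ := h x
      refine ⟨0, p, ?_⟩
      rw [← hp]
      simp [str, Computability.encodeNat, Computability.encodeNum]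

theorem length_trNat_zeroArg_le (τ t : ℕ) : (trNat (zeroArg τ t)).length ≤ t + 1 := by
  unfold zeroArg
  split_ifs <;> simp [trNat_two_pow]

section
variable {S : Finset Λ'} {c₁ c₂ : ToPartrec.Code} {h₁ : trNormal c₁ Cont'.halt ∈ S}
  {h₂ : trNormal c₂ Cont'.halt ∈ S}

/-- The clock `L` cuts off the second program: a timeout rejects, whatever the true answer `a` is.
-/
theorem within_answer (hS : Closed S) {L : List Γ'} {A : List ℕ} {n : ℕ} {a : Bool} {v : Reg}
    (hv : v.s = none) (hA : (trList A).length ≤ n) (hL : L.length ≤ n)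
    (h : ∃ n, next^[n] (init c₂ A) = halt [cond a 1 0]) :
    Within (TM2.step (prog (S := S) ⟨_, h₁⟩ ⟨_, h₂⟩)) (4 * n + 3)
      ⟨some (.run none ⟨_, h₂⟩), v, Mem.fn ⟨[], [], two [] [], two [] [], [], [], L,
        update (fun _ => []) .main (trList A)⟩⟩
      ⟨none, Reg.init, Mem.fn ⟨[], [decide (runtime (init c₂ A) ≤ L.length ∧ a = true)],
        two [] [], two [] [], [], [], [], fun _ => []⟩⟩ := by
  have hstk : update (fun _ => []) .main (trList A) = (init c₂ A).stk := by
    funext k; cases k <;> simp [init]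
  have hlen (k : K') (j : ℕ) (hj : j ≤ L.length) :
      ((next^[j] (init c₂ A)).stk k).length ≤ 3 * n := by
    have h := length_iterate_next_le (init c₂ A) k j
    have h' := length_init_le c₂ A k
    omega
  have hl : ∃ n, (next^[n] (init c₂ A)).l = none := by
    obtain ⟨n, hn⟩ := h
    exact ⟨n, by rw [hn]; rfl⟩
  rw [hstk]
  let T : Mem := ⟨[], [], two [] [], two [] [], [], [], [], fun _ => []⟩
  by_cases hτ : runtime (init c₂ A) ≤ L.length
  · obtain ⟨v₁, g₁⟩ := go_run_halt (l₁ := ⟨_, h₁⟩) (l₂ := ⟨_, h₂⟩) hS none _ T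
      (labelIn_init_of_mem h₂ A) (v := v) hv (L := L) (iterate_runtime_l hl)
      (fun j hj hn => absurd (runtime_le hn) (by omega)) hτ
    have hlen₁ := fun k => hlen k _ hτ
    rw [toLab_init h₂] at g₁
    rw [iterate_runtime_of_halt h] at g₁ hlen₁
    have hs : TM2.step (prog ⟨_, h₁⟩ ⟨_, h₂⟩) ⟨some (.ret none true), v₁,
        (T.set none (L.drop (runtime (init c₂ A))) (halt [cond a 1 0]).stk).fn⟩ =
        some ⟨some (.fin a), { v₁ with s := (trList [cond a 1 0]).head? },
          Mem.fn ⟨[], [], two [] [], two [] [], [], [], L.drop (runtime (init c₂ A)),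
            update (halt [cond a 1 0]).stk .main (trList [cond a 1 0]).tail⟩⟩ := by
      cases a <;> simp [prog, Mem.set, T, put, halt, show trNat 1 = [Γ'.bit1] from rfl]
    have g₂ := within_fin (l₁ := ⟨_, h₁⟩) (l₂ := ⟨_, h₂⟩) (w := two [] []) (z := two [] [])
      (u := []) (clk := []) (lim := L.drop (runtime (init c₂ A)))
      (sim := update (halt [cond a 1 0]).stk .main (trList [cond a 1 0]).tail)
      (v := { v₁ with s := (trList [cond a 1 0]).head? }) a (3 * n)
      (fun k => by
        refine le_trans ?_ (hlen₁ k)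
        cases k <;> simp [halt])
      (by rw [List.length_drop]; omega)
    have ha : decide (runtime (init c₂ A) ≤ L.length ∧ a = true) = a := by simp [hτ]
    rw [ha]
    exact (g₁.trans (Within.head hs g₂)).mono (by omega)
  · obtain ⟨v₁, g₁⟩ := go_run_timeout (l₁ := ⟨_, h₁⟩) (l₂ := ⟨_, h₂⟩) hS none T
      (labelIn_init_of_mem h₂ A) (v := v) hv (L := L)
      (fun j hj hn => absurd (runtime_le hn) (by omega))
    rw [toLab_init h₂] at g₁
    have hs : TM2.step (prog ⟨_, h₁⟩ ⟨_, h₂⟩)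
        ⟨some (.ret none false), v₁, (T.set none [] (next^[L.length] (init c₂ A)).stk).fn⟩ =
        some ⟨some (.fin false), v₁, Mem.fn ⟨[], [], two [] [], two [] [], [], [], [],
          (next^[L.length] (init c₂ A)).stk⟩⟩ := by
      simp [prog, Mem.set, T]
    have g₂ := within_fin (l₁ := ⟨_, h₁⟩) (l₂ := ⟨_, h₂⟩) (w := two [] []) (z := two [] [])
      (u := []) (clk := []) (lim := []) (sim := (next^[L.length] (init c₂ A)).stk)
      (v := v₁) false (3 * n) (fun k => hlen k _ le_rfl) (by simp)
    have ha : decide (runtime (init c₂ A) ≤ L.length ∧ a = true) = false := by simp [hτ]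
    rw [ha]
    exact (g₁.trans (Within.head hs g₂)).mono (by omega)

/-- The numbers computed from two strings, to which the second program is applied. -/
noncomputable def args (c₁ : ToPartrec.Code) (t₀ m₀ t₁ m₁ : ℕ) : List ℕ :=
  [m₀, zeroArg (runtime (init c₁ [m₀])) t₀, m₁, zeroArg (runtime (init c₁ [m₁])) t₁]

theorem within_machine (hS : Closed S) (hc₁ : ∀ m, ∃ n, (next^[n] (init c₁ [m])).l = none)
    (t₀ m₀ t₁ m₁ : ℕ) {a : Bool}
    (h : ∃ n, next^[n] (init c₂ (args c₁ t₀ m₀ t₁ m₁)) = halt [cond a 1 0]) :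
    Within (TM2.step (prog (S := S) ⟨_, h₁⟩ ⟨_, h₂⟩))
      (20 * ((str t₀ m₀).length + (str t₁ m₁).length) + 60)
      ⟨some .split, Reg.init, Mem.fn ⟨(str t₀ m₀).map .inl ++ (str t₁ m₁).map .inr, [],
        two [] [], two [] [], [], [], [], fun _ => []⟩⟩
      ⟨none, Reg.init, Mem.fn ⟨[], [decide (runtime (init c₂ (args c₁ t₀ m₀ t₁ m₁)) ≤
        (str t₀ m₀).length + (str t₁ m₁).length ∧ a = true)],
        two [] [], two [] [], [], [], [], fun _ => []⟩⟩ := by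
  obtain ⟨v₁, g₁⟩ := go_split_left (l₁ := ⟨_, h₁⟩) (l₂ := ⟨_, h₂⟩) (out := []) (w := two [] [])
    (z := two [] []) (u := []) (clk := []) (lim := []) (sim := fun _ => []) (v := Reg.init)
    (inp := (str t₁ m₁).map .inr) (str t₀ m₀)
  rw [map_bit_str, update_two_false, two_false, List.append_nil, List.append_nil] at g₁
  obtain ⟨v₂, g₂⟩ := go_split_right (l₁ := ⟨_, h₁⟩) (l₂ := ⟨_, h₂⟩) (out := [])
    (w := two (List.replicate t₀ .bit0 ++ (trNat m₀).reverse) [])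
    (z := two [] []) (u := []) (clk := []) (lim := List.replicate (str t₀ m₀).length .cons)
    (sim := fun _ => []) (v := v₁) (str t₁ m₁)
  rw [map_bit_str, update_two_true, two_true, List.append_nil] at g₂
  obtain ⟨L, hL⟩ : ∃ L : List Γ', L = List.replicate (str t₁ m₁).length .cons ++
    List.replicate (str t₀ m₀).length .cons := ⟨_, rfl⟩
  have hLl : L.length = (str t₀ m₀).length + (str t₁ m₁).length := by
    rw [hL]; simp [add_comm]
  rw [← hL] at g₂
  obtain ⟨v₃, g₃⟩ := go_decode (h₁ := h₁) (h₂ := h₂)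
    (w := two [] (List.replicate t₁ .bit0 ++ (trNat m₁).reverse)) (z := two [] []) (lim := L)
    (v := v₂) hS false t₀ m₀ (hc₁ m₀) rfl
  simp only [update_two_false, cond_false] at g₃
  obtain ⟨v₄, g₄⟩ := go_decode (h₁ := h₁) (h₂ := h₂)
    (w := two (trNat m₀).reverse [])
    (z := two (trNat (zeroArg (runtime (init c₁ [m₀])) t₀)).reverse []) (lim := L)
    (v := v₃) hS true t₁ m₁ (hc₁ m₁) rfl
  simp only [update_two_true, cond_true] at g₄
  obtain ⟨s₀, hs₀⟩ : ∃ s, s = zeroArg (runtime (init c₁ [m₀])) t₀ := ⟨_, rfl⟩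
  obtain ⟨s₁, hs₁⟩ : ∃ s, s = zeroArg (runtime (init c₁ [m₁])) t₁ := ⟨_, rfl⟩
  have hl₀ : (trNat s₀).length ≤ t₀ + 1 := hs₀ ▸ length_trNat_zeroArg_le _ _
  have hl₁ : (trNat s₁).length ≤ t₁ + 1 := hs₁ ▸ length_trNat_zeroArg_le _ _
  unfold args at h ⊢
  rw [← hs₀] at g₃ g₄ h ⊢
  rw [← hs₁] at g₄ h ⊢
  obtain ⟨v₅, g₅⟩ := go_load_z (l₁ := ⟨_, h₁⟩) (l₂ := ⟨_, h₂⟩) (inp := []) (out := [])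
    (w := two (trNat m₀).reverse (trNat m₁).reverse) (z := two (trNat s₀).reverse [])
    (u := []) (clk := []) (lim := L) (sim := update (fun _ => []) .main [.cons]) (v := v₄) true
    (trNat s₁).reverse
  simp only [update_two_true, update_self, update_idem, List.reverse_reverse] at g₅
  obtain ⟨v₆, g₆⟩ := go_load_w_true (l₁ := ⟨_, h₁⟩) (l₂ := ⟨_, h₂⟩) (inp := []) (out := [])
    (w := two (trNat m₀).reverse []) (z := two (trNat s₀).reverse [])
    (u := []) (clk := []) (lim := L)
    (sim := update (fun _ => []) .main (.cons :: trNat s₁ ++ [.cons])) (v := v₅)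
    (trNat m₁).reverse
  simp only [update_two_true, update_self, update_idem, List.reverse_reverse] at g₆
  obtain ⟨v₇, g₇⟩ := go_load_z (l₁ := ⟨_, h₁⟩) (l₂ := ⟨_, h₂⟩) (inp := []) (out := [])
    (w := two (trNat m₀).reverse []) (z := two [] [])
    (u := []) (clk := []) (lim := L)
    (sim := update (fun _ => []) .main (.cons :: trNat m₁ ++ (.cons :: trNat s₁ ++ [.cons])))
    (v := v₆) false (trNat s₀).reverse
  simp only [update_two_false, update_self, update_idem, List.reverse_reverse] at g₇
  obtain ⟨v₈, hv, g₈⟩ := go_load_w_false (l₁ := ⟨_, h₁⟩) (l₂ := ⟨_, h₂⟩) (inp := []) (out := [])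
    (w := two [] []) (z := two [] []) (u := []) (clk := []) (lim := L)
    (sim := update (fun _ => []) .main
      (.cons :: trNat s₀ ++ (.cons :: trNat m₁ ++ (.cons :: trNat s₁ ++ [.cons]))))
    (v := v₇) (trNat m₀).reverse
  simp only [update_two_false, update_self, update_idem, List.reverse_reverse] at g₈
  have hA : trNat m₀ ++ (.cons :: trNat s₀ ++ (.cons :: trNat m₁ ++
      (.cons :: trNat s₁ ++ [.cons]))) = trList [m₀, s₀, m₁, s₁] := by simp
  rw [hA] at g₈
  have hN₀ := length_str t₀ m₀
  have hN₁ := length_str t₁ m₁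
  -- The `6` covers four separators and the at most one extra digit of each of the two values of
  -- `zeroArg`.
  have g₉ := within_answer (h₁ := h₁) (h₂ := h₂) hS (L := L) (n := L.length + 6) hv
    (by simp; omega) (by omega) h
  rw [hLl] at g₉
  refine (g₁.trans (g₂.trans (g₃.trans (g₄.trans (g₅.trans (g₆.trans (g₇.trans
    (g₈.trans g₉)))))))).mono ?_
  simp only [List.length_reverse]
  omega

end

/-- A relation decided by a program within time linear in the length of the inputs is
polynomial-time computable. -/
theorem pTimeRel_of_codes {c₁ c₂ : ToPartrec.Code} {R : List Bool → List Bool → Prop}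
    (hc₁ : ∀ m, ∃ n, (next^[n] (init c₁ [m])).l = none) {g : ℕ → ℕ → ℕ → ℕ → Bool}
    (hc₂ : ∀ m₀ s₀ m₁ s₁, c₂.eval [m₀, s₀, m₁, s₁] = pure [cond (g m₀ s₀ m₁ s₁) 1 0])
    (hR : ∀ t₀ m₀ t₁ m₁, R (str t₀ m₀) (str t₁ m₁) ↔
      runtime (init c₂ (args c₁ t₀ m₀ t₁ m₁)) ≤ (str t₀ m₀).length + (str t₁ m₁).length ∧
      g m₀ (zeroArg (runtime (init c₁ [m₀])) t₀) m₁ (zeroArg (runtime (init c₁ [m₁])) t₁)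
        = true) :
    TreeStr.PTimeRel R := by
  classical
  let S := codeSupp c₁ Cont'.halt ∪ codeSupp c₂ Cont'.halt
  have hS : Closed S := (closed_codeSupp _ _).union (closed_codeSupp _ _)
  have h₁ : trNormal c₁ Cont'.halt ∈ S :=
    Finset.mem_union_left _ (trNormal_mem_codeSupp _ _)
  have h₂ : trNormal c₂ Cont'.halt ∈ S :=
    Finset.mem_union_right _ (trNormal_mem_codeSupp _ _)
  have key : ∀ p : List Bool × List Bool, ∃ k ≤ 20 * (p.1.length + p.2.length) + 60,
      (flip bind (machine (S := S) ⟨_, h₁⟩ ⟨_, h₂⟩).step)^[k]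
        (some (initList (machine (S := S) ⟨_, h₁⟩ ⟨_, h₂⟩) (p.1.map .inl ++ p.2.map .inr))) =
      some (haltList (machine (S := S) ⟨_, h₁⟩ ⟨_, h₂⟩) [decide (R p.1 p.2)]) := by
    rintro ⟨x, y⟩
    obtain ⟨t₀, m₀, rfl⟩ := exists_eq_str x
    obtain ⟨t₁, m₁, rfl⟩ := exists_eq_str y
    have h := within_machine (h₁ := h₁) (h₂ := h₂) hS hc₁ t₀ m₀ t₁ m₁
      (exists_iterate_eq_halt (hc₂ _ _ _ _))
    have e₁ : (⟨some .split, Reg.init, Mem.fn ⟨(str t₀ m₀).map .inl ++ (str t₁ m₁).map .inr, [],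
        two [] [], two [] [], [], [], [], fun _ => []⟩⟩ : TM2.Cfg Alph (Lab S) Reg) =
        initList (machine (S := S) ⟨_, h₁⟩ ⟨_, h₂⟩)
          ((str t₀ m₀).map .inl ++ (str t₁ m₁).map .inr) := by
      refine congrArg (TM2.Cfg.mk _ _) (funext fun k => ?_)
      rcases k with _ | _ | b | b | _ | _ | _ | _ <;> try rfl
      all_goals cases b <;> rfl
    have e₂ (L : List Bool) : (⟨none, Reg.init, Mem.fn ⟨[], L, two [] [], two [] [], [], [], [],
        fun _ => []⟩⟩ : TM2.Cfg Alph (Lab S) Reg) =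
        haltList (machine (S := S) ⟨_, h₁⟩ ⟨_, h₂⟩) L := by
      refine congrArg (TM2.Cfg.mk _ _) (funext fun k => ?_)
      rcases k with _ | _ | b | b | _ | _ | _ | _ <;> try rfl
      all_goals cases b <;> rfl
    rw [e₁, e₂] at h
    obtain ⟨k, hk, h⟩ := h
    refine ⟨k, hk, ?_⟩
    have hd : decide (R (str t₀ m₀) (str t₁ m₁)) = decide _ :=
      decide_eq_decide.2 (hR t₀ m₀ t₁ m₁)
    rw [hd]
    exact h
  choose k hk hk' using key
  refine ⟨{ tm := machine (S := S) ⟨_, h₁⟩ ⟨_, h₂⟩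
            inputAlphabet := Equiv.refl (Bool ⊕ Bool)
            outputAlphabet := Equiv.refl Bool
            time := 20 * .X + 60
            outputsFun := fun p => ⟨⟨k p, ?_⟩, ?_⟩ }⟩
  · have e₁ : List.map (Equiv.refl (Bool ⊕ Bool)).invFun ((Computability.encodingProd
        (Computability.encodingList Bool) (Computability.encodingList Bool)).encode p) =
        p.1.map .inl ++ p.2.map .inr := by
      simp [Computability.encodingProd, Computability.encodingList]
    have e₂ : List.map (Equiv.refl Bool).invFun
        (Computability.encodingBoolBool.encode (decide (R p.1 p.2))) = [decide (R p.1 p.2)] := by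
      simp [Computability.encodingBoolBool, Computability.encodeBool]
    exact (congrArg (fun L => (flip bind (machine (S := S) ⟨_, h₁⟩ ⟨_, h₂⟩).step)^[k p]
      (some (initList (machine (S := S) ⟨_, h₁⟩ ⟨_, h₂⟩) L))) e₁).trans ((hk' p).trans
        (congrArg (fun L => some (haltList (machine (S := S) ⟨_, h₁⟩ ⟨_, h₂⟩) L)) e₂.symm))
  · refine (hk p).trans (le_of_eq ?_)
    simp [Computability.encodingProd, Computability.encodingList]

end Turing.PartrecToTM2

/-! ### Domination by running times and the numbering of strings. -/

namespace Turing.PartrecToTM2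
open Function

theorem exists_code_one {f : ℕ → ℕ} (hf : Computable f) :
    ∃ c : ToPartrec.Code, ∀ m, c.eval [m] = pure [f m] := by
  obtain ⟨c, hc⟩ := ToPartrec.Code.exists_code (n := 1) (f := fun v => Part.some (f v.head))
    (Nat.Partrec'.of_part (hf.comp Computable.vector_head).partrec)
  refine ⟨c, fun m => ?_⟩
  have := hc ⟨[m], rfl⟩
  rw [this]
  exact Part.map_some _ _

theorem exists_code_four {g : (ℕ × ℕ) × (ℕ × ℕ) → Bool} (hg : Computable g) :
    ∃ c : ToPartrec.Code, ∀ m₀ s₀ m₁ s₁, c.eval [m₀, s₀, m₁, s₁] =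
      pure [cond (g ((m₀, s₀), (m₁, s₁))) 1 0] := by
  have hv (i : Fin 4) : Computable fun v : List.Vector ℕ 4 => v.get i :=
    Computable.vector_get.comp Computable.id (Computable.const i)
  have hf : Computable fun v : List.Vector ℕ 4 =>
      cond (g ((v.get 0, v.get 1), (v.get 2, v.get 3))) 1 0 :=
    Computable.cond (hg.comp (((hv 0).pair (hv 1)).pair ((hv 2).pair (hv 3))))
      (Computable.const 1) (Computable.const 0)
  obtain ⟨c, hc⟩ := ToPartrec.Code.exists_code (n := 4) (Nat.Partrec'.of_part hf.partrec)
  refine ⟨c, fun m₀ s₀ m₁ s₁ => ?_⟩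
  have := hc ⟨[m₀, s₀, m₁, s₁], rfl⟩
  rw [this]
  exact Part.map_some _ _

theorem length_trNat_le (m : ℕ) : (trNat m).length ≤ m := by
  induction m using Nat.strong_induction_on with
  | _ m ih =>
    rw [trNat_eq]
    split_ifs with h
    · simp
    all_goals
      have h₁ : m.div2 < m := by rw [Nat.div2_val]; omega
      have := ih _ h₁
      simp only [List.length_cons]
      omega

/-- Every computable function is dominated by the running time of some code. -/
theorem exists_code_le_runtime {h : ℕ → ℕ} (hh : Computable h) :
    ∃ c : ToPartrec.Code, (∀ m, ∃ n, (next^[n] (init c [m])).l = none) ∧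
      ∀ m, h m ≤ runtime (init c [m]) := by
  have hpow : Primrec fun n : ℕ => 2 ^ n := by
    refine (Primrec.nat_rec₁ 1 (f := fun _ a => a + a)
      (Primrec.nat_add.comp Primrec.snd Primrec.snd)).of_eq fun n => ?_
    induction n with
    | zero => rfl
    | succ n ih => rw [pow_succ, mul_two, ← ih]
  -- A power of two has as many zeros as its exponent. The summand `m` absorbs the length of the
  -- input, and `h m` is doubled because a step may push two symbols.
  have hf : Computable fun m => 2 ^ (h m + h m + m) :=
    hpow.to_comp.comp (Primrec.nat_add.to_comp.comp (Primrec.nat_add.to_comp.comp hh hh)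
      Computable.id)
  obtain ⟨c, hc⟩ := exists_code_one hf
  refine ⟨c, fun m => ?_, fun m => ?_⟩
  · obtain ⟨n, hn⟩ := exists_iterate_eq_halt (hc m)
    exact ⟨n, by rw [hn]; rfl⟩
  · have h₁ := length_iterate_next_le (init c [m]) .main (runtime (init c [m]))
    rw [iterate_runtime_of_halt (exists_iterate_eq_halt (hc m))] at h₁
    have h₂ := length_init_le c [m] .main
    have h₃ := length_trNat_le m
    simp only [halt, trList, K'.elim, trNat_two_pow, List.length_append, List.length_replicate,
      List.length_cons, List.length_nil] at h₁ h₂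
    omega

/-- The number coded by a pair of numbers, the second of which is `0` or a power of two. -/
def pos (m s : ℕ) : ℕ := if s = 0 then 2 * m else 2 * (s * (2 * m + 1)) - 1

theorem primrec_pos : Primrec₂ pos := by
  have h2 : Primrec fun p : ℕ × ℕ => 2 * p.1 := Primrec.nat_double.comp Primrec.fst
  refine Primrec.ite (Primrec.eq.comp Primrec.snd (Primrec.const 0)) h2 ?_
  exact Primrec.nat_sub.comp (Primrec.nat_double.comp (Primrec.nat_mul.comp Primrec.snd
    (Primrec.succ.comp h2))) (Primrec.const 1)

theorem pos_zero (m : ℕ) : pos m 0 = 2 * m := if_pos rfl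

theorem pos_odd {m s : ℕ} (hs : s ≠ 0) : ¬ Even (pos m s) := by
  rw [pos, if_neg hs, Nat.not_even_iff_odd]
  have : 0 < s * (2 * m + 1) := by positivity
  exact ⟨s * (2 * m + 1) - 1, by omega⟩

theorem le_pos (m s : ℕ) : m ≤ pos m s ∧ s ≤ pos m s := by
  unfold pos
  split_ifs with h
  · omega
  · have h₁ : 1 ≤ s := Nat.one_le_iff_ne_zero.2 h
    have h₂ : s * 1 ≤ s * (2 * m + 1) := Nat.mul_le_mul_left _ (by omega)
    have h₃ : 1 * (2 * m + 1) ≤ s * (2 * m + 1) := Nat.mul_le_mul_right _ h₁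
    omega

theorem two_pow_mul_odd_inj {j m j' m' : ℕ} (h : 2 ^ j * (2 * m + 1) = 2 ^ j' * (2 * m' + 1)) :
    j = j' ∧ m = m' := by
  induction j generalizing j' with
  | zero =>
    cases j' with
    | zero => omega
    | succ j' => rw [pow_succ', mul_assoc] at h; omega
  | succ j ih =>
    cases j' with
    | zero => rw [pow_succ', mul_assoc] at h; omega
    | succ j' =>
      rw [pow_succ', pow_succ', mul_assoc, mul_assoc] at h
      have := ih (Nat.eq_of_mul_eq_mul_left two_pos h)
      omega

theorem zeroArg_self (τ : ℕ) : zeroArg τ τ = 0 := if_pos rfl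

theorem zeroArg_of_ne {τ t : ℕ} (h : t ≠ τ) :
    zeroArg τ t = 2 ^ (if t < τ then t else t - 1) := by
  rw [zeroArg, if_neg h]
  split_ifs <;> rfl

theorem zeroArg_eq_zero {τ t : ℕ} : zeroArg τ t = 0 ↔ t = τ := by
  refine ⟨fun h => ?_, fun h => h ▸ zeroArg_self τ⟩
  by_contra hne
  rw [zeroArg_of_ne hne] at h
  exact absurd h (by positivity)

/-- Even positions come from `t = τ m`. For the others, skipping the value `τ m` makes the remaining
`t` correspond bijectively to the exponents `j`, and every positive integer is uniquely `2 ^ j * (2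
* m + 1)`. -/
theorem bijective_pos_zeroArg (τ : ℕ → ℕ) :
    Bijective fun p : ℕ × ℕ => pos p.2 (zeroArg (τ p.2) p.1) := by
  constructor
  · rintro ⟨t, m⟩ ⟨t', m'⟩ h
    dsimp only at h
    by_cases ht : t = τ m
    · by_cases ht' : t' = τ m'
      · subst ht ht'
        rw [zeroArg_self, zeroArg_self, pos_zero, pos_zero] at h
        obtain rfl : m = m' := by omega
        rfl
      · refine absurd ?_ (pos_odd (m := m') (mt zeroArg_eq_zero.1 ht'))
        rw [← h, ht, zeroArg_self, pos_zero]
        exact even_two_mul m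
    · by_cases ht' : t' = τ m'
      · refine absurd ?_ (pos_odd (m := m) (mt zeroArg_eq_zero.1 ht))
        rw [h, ht', zeroArg_self, pos_zero]
        exact even_two_mul m'
      · have h₁ := mt zeroArg_eq_zero.1 ht
        have h₂ := mt zeroArg_eq_zero.1 ht'
        rw [pos, pos, if_neg h₁, if_neg h₂] at h
        have h₃ : 0 < zeroArg (τ m) t * (2 * m + 1) := by positivity
        have h₄ : 0 < zeroArg (τ m') t' * (2 * m' + 1) := by positivity
        have h₅ : zeroArg (τ m) t * (2 * m + 1) = zeroArg (τ m') t' * (2 * m' + 1) := by omega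
        rw [zeroArg_of_ne ht, zeroArg_of_ne ht'] at h₅
        obtain ⟨h₆, rfl⟩ := two_pow_mul_odd_inj h₅
        have : t = t' := by split_ifs at h₆ <;> omega
        rw [this]
  · intro n
    rcases Nat.even_or_odd' n with ⟨m, rfl | rfl⟩
    · exact ⟨(τ m, m), by simp only [zeroArg_self, pos_zero]⟩
    · obtain ⟨j, q, ⟨m', rfl⟩, hj⟩ := Nat.exists_eq_two_pow_mul_odd (Nat.succ_ne_zero m)
      have key {t : ℕ} (ht : t ≠ τ m') (hj' : (if t < τ m' then t else t - 1) = j) :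
          pos m' (zeroArg (τ m') t) = 2 * m + 1 := by
        rw [pos, if_neg (mt zeroArg_eq_zero.1 ht), zeroArg_of_ne ht, hj', ← hj]
        omega
      by_cases h : j < τ m'
      · exact ⟨(j, m'), key h.ne (if_pos h)⟩
      · exact ⟨(j + 1, m'), key (by omega) (by rw [if_neg (by omega)]; rfl)⟩

theorem pair_le_pair {a b c d : ℕ} (h₁ : a ≤ c) (h₂ : b ≤ d) : Nat.pair a b ≤ Nat.pair c d := by
  refine le_trans (b := Nat.pair c b) ?_ ?_
  · rcases h₁.eq_or_lt with rfl | h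
    · exact le_rfl
    · exact (Nat.pair_lt_pair_left b h).le
  · rcases h₂.eq_or_lt with rfl | h
    · exact le_rfl
    · exact (Nat.pair_lt_pair_right c h).le

/-- A computable function of four numbers is bounded by a computable function of their maximum. -/
theorem exists_computable_bound {r : (ℕ × ℕ) × (ℕ × ℕ) → ℕ} (hr : Computable r) :
    ∃ h : ℕ → ℕ, Computable h ∧ ∀ n a b c d, a ≤ n → b ≤ n → c ≤ n → d ≤ n →
      r ((a, b), (c, d)) ≤ h n := by
  let F (i : ℕ) : (ℕ × ℕ) × (ℕ × ℕ) := (i.unpair.1.unpair, i.unpair.2.unpair)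
  have hF : Computable F :=
    (Computable.unpair.comp (Computable.fst.comp Computable.unpair)).pair
      (Computable.unpair.comp (Computable.snd.comp Computable.unpair))
  -- Partial sums give a computable monotone bound over all codes below `n`; pairing is monotone, so
  -- quadruples bounded by `n` have codes below `E n`.
  let s (n : ℕ) : ℕ := n.rec 0 fun i a => a + r (F i)
  have hs : Computable s :=
    Computable.nat_rec (f := id) (g := fun _ => 0) (h := fun _ p => p.2 + r (F p.1))
      Computable.id (Computable.const 0) (Primrec.nat_add.to_comp.comp
        (Computable.snd.comp Computable.snd)
        (hr.comp (hF.comp (Computable.fst.comp Computable.snd))))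
  have hle {i n : ℕ} (hi : i < n) : r (F i) ≤ s n := by
    induction n with
    | zero => omega
    | succ n ih =>
      change _ ≤ s n + r (F n)
      rcases Nat.lt_succ_iff_lt_or_eq.1 hi with hi | rfl
      · exact (ih hi).trans (Nat.le_add_right _ _)
      · exact Nat.le_add_left _ _
  let E (n : ℕ) : ℕ := Nat.pair (Nat.pair n n) (Nat.pair n n) + 1
  have hE : Primrec E := by
    have := Primrec₂.natPair.comp Primrec.id Primrec.id
    exact Primrec.succ.comp (Primrec₂.natPair.comp this this)
  refine ⟨fun n => s (E n), hs.comp hE.to_comp, fun n a b c d ha hb hc hd => ?_⟩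
  have := hle (i := Nat.pair (Nat.pair a b) (Nat.pair c d)) (n := E n)
    (Nat.lt_succ_of_le (pair_le_pair (pair_le_pair ha hb) (pair_le_pair hc hd)))
  simpa [F] using this

end Turing.PartrecToTM2

/-! ### A computable enumeration with unrelated odd entries. -/

theorem Computable.list_all {α β : Type} [Primcodable α] [Primcodable β] {p : α → β → Bool}
    (hp : Computable₂ p) : Computable₂ fun (a : α) (L : List β) => L.all (p a) := by
  let g (x : α × List β) (i : ℕ) : Bool :=
    Option.casesOn (motive := fun _ => Bool) x.2[i]? true fun b => p x.1 b
  have hg : Computable₂ g := by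
    refine Computable.option_casesOn (o := fun q : (α × List β) × ℕ => q.1.2[q.2]?)
      (f := fun _ => true) (g := fun q b => p q.1.1 b) ?_ (Computable.const true) ?_
    · exact Computable.list_getElem?.comp (Computable.snd.comp Computable.fst) Computable.snd
    · exact Computable₂.comp hp (Computable.fst.comp (Computable.fst.comp Computable.fst))
        Computable.snd
  let all (x : α × List β) (n : ℕ) : Bool := n.rec true fun i acc => acc && g x i
  have h : Computable fun x => all x x.2.length :=
    Computable.nat_rec (f := fun x : α × List β => x.2.length) (g := fun _ => true)
      (h := fun x q => q.2 && g x q.1) (Computable.list_length.comp Computable.snd)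
      (Computable.const true) (Computable₂.comp Primrec.and.to_comp
        (Computable.snd.comp Computable.snd)
        (hg.comp Computable.fst (Computable.fst.comp Computable.snd)))
  refine h.of_eq fun ⟨a, L⟩ => ?_
  have key (n : ℕ) (hn : n ≤ L.length) : all (a, L) n = (L.take n).all (p a) := by
    induction n with
    | zero => rfl
    | succ n ih =>
      have hn' : n < L.length := hn
      change (all (a, L) n && g (a, L) n) = _
      simp only [ih hn'.le, List.take_add_one, List.getElem?_eq_getElem hn', List.all_append, g]
      simp
  simpa using key L.length le_rfl

/-- Given a computable set `d` and a computable relation `r` such that every finite set of numbers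
is unrelated to some element of `d` outside it, there is a computable enumeration of `d` without
repetitions whose elements in odd positions are unrelated to all earlier ones. -/
theorem exists_enumeration {d : ℕ → Bool} (hd : Computable d) {r : ℕ → ℕ → Bool}
    (hr : Computable₂ r)
    (h : ∀ L : List ℕ, ∃ a, d a = true ∧ ∀ b ∈ L, b ≠ a ∧ r b a = false) :
    ∃ e : ℕ → ℕ, Computable e ∧ Function.Injective e ∧ (∀ a, (∃ n, e n = a) ↔ d a = true) ∧
      ∀ k n, k < n → ¬ Even n → r (e k) (e n) = false := by
  -- Repetition is always forbidden, but being unrelated is required only when the number of earlier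
  -- entries is odd.
  let t (a b : ℕ) (odd : Bool) : Bool := !(b == a) && !(odd && r b a)
  let P (L : List ℕ) (a : ℕ) : Prop :=
    (d a && L.all fun b => t a b L.length.bodd) = true
  have hP : ComputablePred fun p : List ℕ × ℕ => P p.1 p.2 := by
    refine ComputablePred.computable_iff.2 ⟨_, Primrec.and.to_comp.comp (hd.comp Computable.snd)
      ((Computable.list_all (p := fun (q : ℕ × Bool) b => t q.1 b q.2) ?_).comp
        (Computable.snd.pair (Computable.nat_bodd.comp
          (Computable.list_length.comp Computable.fst))) Computable.fst), rfl⟩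
    refine Primrec.and.to_comp.comp (Primrec.not.to_comp.comp (Primrec.beq.to_comp.comp
      Computable.snd (Computable.fst.comp Computable.fst))) (Primrec.not.to_comp.comp
        (Primrec.and.to_comp.comp (Computable.snd.comp Computable.fst)
          (hr.comp Computable.snd (Computable.fst.comp Computable.fst))))
  have hex (L : List ℕ) : ∃ a, P L a := by
    obtain ⟨a, ha, hL⟩ := h L
    refine ⟨a, ?_⟩
    simp only [P, t, ha, Bool.true_and, List.all_eq_true]
    intro b hb
    simp [hL b hb]
  let nx (L : List ℕ) : ℕ := Nat.find (hex L)
  have hnx : Computable nx := Computable.find hP hex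
  let H (n : ℕ) : List ℕ := n.rec [] fun _ L => L ++ [nx L]
  have hH : Computable H :=
    Computable.nat_rec (f := id) (g := fun _ => []) (h := fun _ p => p.2 ++ [nx p.2])
      Computable.id (Computable.const []) (Computable.list_concat.comp
        (Computable.snd.comp Computable.snd) (hnx.comp (Computable.snd.comp Computable.snd)))
  let e (n : ℕ) : ℕ := nx (H n)
  have hHs (n : ℕ) : H (n + 1) = H n ++ [e n] := rfl
  have hHl (n : ℕ) : (H n).length = n := by
    induction n with
    | zero => rfl
    | succ n ih => rw [hHs, List.length_append, ih]; rfl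
  have hHm {a n : ℕ} : a ∈ H n ↔ ∃ k < n, e k = a := by
    induction n with
    | zero => simp [H]
    | succ n ih =>
      rw [hHs, List.mem_append, ih, List.mem_singleton]
      constructor
      · rintro (⟨k, hk, rfl⟩ | rfl)
        · exact ⟨k, by omega, rfl⟩
        · exact ⟨n, by omega, rfl⟩
      · rintro ⟨k, hk, rfl⟩
        rcases Nat.lt_succ_iff_lt_or_eq.1 hk with hk | rfl
        · exact Or.inl ⟨k, hk, rfl⟩
        · exact Or.inr rfl
  have hspec (n : ℕ) : d (e n) = true ∧
      ∀ k < n, e k ≠ e n ∧ (¬ Even n → r (e k) (e n) = false) := by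
    have hn : P (H n) (e n) := Nat.find_spec (hex (H n))
    simp only [P, t, hHl, Bool.and_eq_true, List.all_eq_true] at hn
    refine ⟨hn.1, fun k hk => ?_⟩
    have := hn.2 (e k) (hHm.2 ⟨k, hk, rfl⟩)
    refine ⟨by simpa using this.1, fun hodd => ?_⟩
    have hb : n.bodd = true := by
      by_contra hb
      exact hodd (Nat.even_iff.2 (by rw [Nat.mod_two_of_bodd]; simp [hb]))
    simpa [hb] using this.2
  have hinj : Function.Injective e := by
    intro k n hkn
    rcases lt_trichotomy k n with h | h | h
    · exact absurd hkn ((hspec n).2 k h).1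
    · exact h
    · exact absurd hkn.symm ((hspec k).2 n h).1
  refine ⟨e, hnx.comp hH, hinj, fun a => ⟨?_, fun ha => ?_⟩, fun k n hk hn =>
    ((hspec n).2 k hk).2 hn⟩
  · rintro ⟨n, rfl⟩
    exact (hspec n).1
  · by_contra hne
    -- A missed `a` would be a candidate at every even stage, so minimality keeps all even entries
    -- at most `a`, against injectivity by the pigeonhole principle.
    have hlt (m : ℕ) : e (2 * m) < a + 1 := by
      refine Nat.lt_succ_of_le (Nat.find_min' (hex (H (2 * m))) ?_)
      have hb : (2 * m).bodd = false := by simp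
      simp only [P, t, hHl, hb, ha, Bool.true_and, List.all_eq_true]
      intro b hb
      obtain ⟨k, -, rfl⟩ := hHm.1 hb
      simpa using fun h => hne ⟨k, h⟩
    have : Function.Injective fun m : Fin (a + 2) => (⟨e (2 * m), hlt m⟩ : Fin (a + 1)) := by
      intro m m' hm
      have := hinj (Fin.mk.inj hm)
      exact Fin.ext (by omega)
    simpa using Fintype.card_le_of_injective _ this

/-! ### Depth and distance in r.p.o. trees. -/

namespace TreeStr

variable {α : Type} {S : TreeStr α}

/-- The depth of a node is its distance to the root. -/
theorem HasDepth.dist_eq (hS : S.IsRPOTree) {a : α} {n : ℕ} (h : S.HasDepth a n) :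
    S.graph.dist a S.root = n := by
  induction h with
  | root => simp
  | child hp _ ih => rw [hS.towards_root _ _ hp, ih]

theorem IsRPOTree.dist_eq_of_lt (hS : S.IsRPOTree) {x y : α} (h : S.Lt x y) :
    S.graph.dist x S.root = S.graph.dist y S.root := by
  have hne : x ≠ y := fun hxy => hS.lt_irrefl y (hxy ▸ h)
  obtain ⟨z, hx, hy⟩ := (hS.comparable_iff x y hne).1 (Or.inl h)
  rw [hS.towards_root _ _ hx, hS.towards_root _ _ hy]

/-- The nodes `x` and `y` are adjacent or siblings. -/
def Near (S : TreeStr α) (x y : α) : Prop := S.Pred x y ∨ S.Pred y x ∨ S.Lt x y ∨ S.Lt y x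

theorem IsRPOTree.not_near_self (hS : S.IsRPOTree) (x : α) : ¬ S.Near x x := by
  rintro (h | h | h | h)
  · have := hS.towards_root _ _ h; omega
  · have := hS.towards_root _ _ h; omega
  · exact hS.lt_irrefl _ h
  · exact hS.lt_irrefl _ h

theorem IsRPOTree.dist_le_of_near (hS : S.IsRPOTree) {x y : α} (h : S.Near x y) :
    S.graph.dist y S.root ≤ S.graph.dist x S.root + 1 := by
  rcases h with h | h | h | h
  · have := hS.towards_root _ _ h; omega
  · have := hS.towards_root _ _ h; omega
  · have := hS.dist_eq_of_lt h; omega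
  · have := hS.dist_eq_of_lt h; omega

/-- In a tree of unbounded depth, any finitely many nodes are far from some other node. -/
theorem exists_not_near (hS : S.IsRPOTree) (hdepth : S.UnboundedDepth) (L : List α) :
    ∃ a, ∀ b ∈ L, b ≠ a ∧ ¬ S.Near b a := by
  obtain ⟨B, hB⟩ : ∃ B, ∀ b ∈ L, S.graph.dist b S.root ≤ B := by
    induction L with
    | nil => exact ⟨0, by simp⟩
    | cons b L ih =>
      obtain ⟨B, hB⟩ := ih
      refine ⟨max B (S.graph.dist b S.root), fun c hc => ?_⟩
      rcases List.mem_cons.1 hc with rfl | hc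
      · exact le_max_right _ _
      · exact (hB c hc).trans (le_max_left _ _)
  obtain ⟨a, m, hm, ha⟩ := hdepth (B + 2)
  have ha := ha.dist_eq hS
  refine ⟨a, fun b hb => ⟨?_, fun hn => ?_⟩⟩
  · rintro rfl
    have := hB b hb
    omega
  · have := hB b hb
    have := hS.dist_le_of_near hn
    omega

end TreeStr

/-! ### Padding and construction of the polynomial-time copy. -/

namespace TreeStr
open Turing.PartrecToTM2

/-- Let `F` and `G` be computable relations on pairs of numbers which only relate distinct
positions, the larger of which has second coordinate `0`. If the strings for these positions are
padded long enough, both relations become polynomial-time computable. -/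
theorem exists_pTimeRel {F G : (ℕ × ℕ) × (ℕ × ℕ) → Bool} (hF : Computable F) (hG : Computable G)
    (hFG : ∀ m₀ s₀ m₁ s₁, (F ((m₀, s₀), (m₁, s₁)) = true ∨ G ((m₀, s₀), (m₁, s₁)) = true) →
      pos m₀ s₀ < pos m₁ s₁ ∧ s₁ = 0 ∨ pos m₁ s₁ < pos m₀ s₀ ∧ s₀ = 0) :
    ∃ τ : ℕ → ℕ, ∀ R R' : List Bool → List Bool → Prop,
      (∀ t₀ m₀ t₁ m₁, R (str t₀ m₀) (str t₁ m₁) ↔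
        F ((m₀, zeroArg (τ m₀) t₀), (m₁, zeroArg (τ m₁) t₁)) = true) →
      (∀ t₀ m₀ t₁ m₁, R' (str t₀ m₀) (str t₁ m₁) ↔
        G ((m₀, zeroArg (τ m₀) t₀), (m₁, zeroArg (τ m₁) t₁)) = true) →
      PTimeRel R ∧ PTimeRel R' := by
  obtain ⟨c, hc⟩ := exists_code_four hF
  obtain ⟨c', hc'⟩ := exists_code_four hG
  let f (q : (ℕ × ℕ) × (ℕ × ℕ)) : List ℕ := [q.1.1, q.1.2, q.2.1, q.2.2]
  have hf : Computable f := by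
    have p₁ : Primrec fun q : (ℕ × ℕ) × (ℕ × ℕ) => q.1.1 := Primrec.fst.comp Primrec.fst
    have p₂ : Primrec fun q : (ℕ × ℕ) × (ℕ × ℕ) => q.1.2 := Primrec.snd.comp Primrec.fst
    have p₃ : Primrec fun q : (ℕ × ℕ) × (ℕ × ℕ) => q.2.1 := Primrec.fst.comp Primrec.snd
    have p₄ : Primrec fun q : (ℕ × ℕ) × (ℕ × ℕ) => q.2.2 := Primrec.snd.comp Primrec.snd
    exact (Primrec.list_cons.comp p₁ (Primrec.list_cons.comp p₂ (Primrec.list_cons.comp p₃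
      (Primrec.list_cons.comp p₄ (Primrec.const []))))).to_comp
  have hr (c : Turing.ToPartrec.Code) {g : (ℕ × ℕ) × (ℕ × ℕ) → Bool}
      (hc : ∀ m₀ s₀ m₁ s₁, c.eval [m₀, s₀, m₁, s₁] =
        pure [cond (g ((m₀, s₀), (m₁, s₁))) 1 0]) :
      Computable fun q => runtime (init c (f q)) := by
    refine computable_runtime c hf fun q => ?_
    obtain ⟨n, hn⟩ := exists_iterate_eq_halt (hc q.1.1 q.1.2 q.2.1 q.2.2)
    exact ⟨n, by rw [hn]; rfl⟩
  obtain ⟨h, hh, hle⟩ := exists_computable_bound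
    (Primrec.nat_add.to_comp.comp (hr c hc) (hr c' hc'))
  -- The bound is taken at `2 * m`, the position of the padded string of `m`.
  obtain ⟨c₁, hc₁, hτ⟩ := exists_code_le_runtime (hh.comp Primrec.nat_double.to_comp)
  have time (t₀ m₀ t₁ m₁ : ℕ)
      (hpos : ∃ H, (H = F ∨ H = G) ∧ H ((m₀, zeroArg (runtime (init c₁ [m₀])) t₀),
        (m₁, zeroArg (runtime (init c₁ [m₁])) t₁)) = true) :
      runtime (init c (args c₁ t₀ m₀ t₁ m₁)) + runtime (init c' (args c₁ t₀ m₀ t₁ m₁)) ≤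
        (str t₀ m₀).length + (str t₁ m₁).length := by
    have h₀ := le_pos m₀ (zeroArg (runtime (init c₁ [m₀])) t₀)
    have h₁ := le_pos m₁ (zeroArg (runtime (init c₁ [m₁])) t₁)
    rw [length_str, length_str]
    rcases hFG m₀ (zeroArg (runtime (init c₁ [m₀])) t₀) m₁
      (zeroArg (runtime (init c₁ [m₁])) t₁) (by
        obtain ⟨_, rfl | rfl, h⟩ := hpos
        exacts [.inl h, .inr h]) with ⟨hlt, hz⟩ | ⟨hlt, hz⟩
    -- The larger position is `2 * m₁`, and by `le_pos` it bounds all four numbers, so both programs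
    -- halt within `h (2 * m₁) ≤ τ m₁ = t₁` steps, at most the input length.
    · have hp := pos_zero m₁
      rw [← hz] at hp
      have := hle (2 * m₁) _ _ _ _ (h₀.1.trans (by omega)) (h₀.2.trans (by omega))
        (h₁.1.trans (by omega)) (h₁.2.trans (by omega))
      have h₂ := hτ m₁
      rw [← zeroArg_eq_zero.1 hz] at h₂
      exact this.trans (h₂.trans (by omega))
    · have hp := pos_zero m₀
      rw [← hz] at hp
      have := hle (2 * m₀) _ _ _ _ (h₀.1.trans (by omega)) (h₀.2.trans (by omega))
        (h₁.1.trans (by omega)) (h₁.2.trans (by omega))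
      have h₂ := hτ m₀
      rw [← zeroArg_eq_zero.1 hz] at h₂
      exact this.trans (h₂.trans (by omega))
  refine ⟨fun m => runtime (init c₁ [m]), fun R R' hR hR' =>
    ⟨pTimeRel_of_codes hc₁ hc fun t₀ m₀ t₁ m₁ => ?_,
      pTimeRel_of_codes hc₁ hc' fun t₀ m₀ t₁ m₁ => ?_⟩⟩
  · rw [hR]
    exact ⟨fun h => ⟨(Nat.le_add_right _ _).trans (time t₀ m₀ t₁ m₁ ⟨F, .inl rfl, h⟩), h⟩, And.right⟩
  · rw [hR']
    exact ⟨fun h => ⟨(Nat.le_add_left _ _).trans (time t₀ m₀ t₁ m₁ ⟨G, .inr rfl, h⟩), h⟩, And.right⟩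

end TreeStr

open Turing.PartrecToTM2 in
theorem theorem4 (D : Set ℕ) (T : TreeStr D) (hT : T.IsRPOTree) (hcomp : T.IsComputable)
    (hdepth : T.UnboundedDepth) : T.FullyPTimePresentable := by
  obtain ⟨d, hd, hdD⟩ := ComputablePred.computable_iff.1 hcomp.dom
  obtain ⟨P, hP, hPT⟩ := ComputablePred.computable_iff.1 hcomp.pred
  obtain ⟨L, hL, hLT⟩ := ComputablePred.computable_iff.1 hcomp.lt
  have hdD (a : ℕ) : a ∈ D ↔ d a = true := iff_of_eq (congrFun hdD a)
  have hPT (a b : ℕ) : P (a, b) = true ↔ ∃ (hx : a ∈ D) (hy : b ∈ D), T.Pred ⟨a, hx⟩ ⟨b, hy⟩ :=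
    (iff_of_eq (congrFun hPT (a, b))).symm
  have hLT (a b : ℕ) : L (a, b) = true ↔ ∃ (hx : a ∈ D) (hy : b ∈ D), T.Lt ⟨a, hx⟩ ⟨b, hy⟩ :=
    (iff_of_eq (congrFun hLT (a, b))).symm
  let r (a b : ℕ) : Bool := P (a, b) || (P (b, a) || (L (a, b) || L (b, a)))
  have hr : Computable₂ r := by
    have sw : Computable fun p : ℕ × ℕ => (p.2, p.1) := Computable.snd.pair Computable.fst
    exact Primrec.or.to_comp.comp hP (Primrec.or.to_comp.comp (hP.comp sw)
      (Primrec.or.to_comp.comp hL (hL.comp sw)))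
  have hrT (a b : ℕ) : r a b = true ↔ ∃ (hx : a ∈ D) (hy : b ∈ D), T.Near ⟨a, hx⟩ ⟨b, hy⟩ := by
    simp only [r, Bool.or_eq_true, hPT, hLT, TreeStr.Near]
    constructor
    · rintro (⟨h₁, h₂, h⟩ | ⟨h₁, h₂, h⟩ | ⟨h₁, h₂, h⟩ | ⟨h₁, h₂, h⟩)
      · exact ⟨h₁, h₂, .inl h⟩
      · exact ⟨h₂, h₁, .inr (.inl h)⟩
      · exact ⟨h₁, h₂, .inr (.inr (.inl h))⟩
      · exact ⟨h₂, h₁, .inr (.inr (.inr h))⟩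
    · rintro ⟨h₁, h₂, h | h | h | h⟩
      · exact .inl ⟨h₁, h₂, h⟩
      · exact .inr (.inl ⟨h₂, h₁, h⟩)
      · exact .inr (.inr (.inl ⟨h₁, h₂, h⟩))
      · exact .inr (.inr (.inr ⟨h₂, h₁, h⟩))
  have r_symm (a b : ℕ) : r a b = r b a := by
    simp only [r, ← Bool.or_assoc, Bool.or_comm (P (b, a)), Bool.or_right_comm _ (L (b, a))]
  obtain ⟨e, he, he_inj, he_range, he_odd⟩ := exists_enumeration hd hr fun l => by
    classical
    obtain ⟨a, ha⟩ := TreeStr.exists_not_near hT hdepth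
      (l.filterMap fun b => if h : b ∈ D then some (⟨b, h⟩ : D) else none)
    have ha (b : D) (hb : b.1 ∈ l) : b ≠ a ∧ ¬ T.Near b a :=
      ha b (List.mem_filterMap.2 ⟨b, hb, by simp⟩)
    refine ⟨a, (hdD a).1 a.2, fun b hb => ⟨?_, ?_⟩⟩
    · rintro rfl
      exact (ha a hb).1 rfl
    · rw [← Bool.not_eq_true, hrT]
      rintro ⟨hx, hy, h⟩
      exact (ha ⟨b, hx⟩ hb).2 h
  have he_mem (n : ℕ) : e n ∈ D := (hdD _).2 ((he_range _).1 ⟨n, rfl⟩)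
  have hep : Computable fun q : (ℕ × ℕ) × (ℕ × ℕ) => (e (pos q.1.1 q.1.2), e (pos q.2.1 q.2.2)) :=
    (he.comp (primrec_pos.to_comp.comp (Computable.fst.comp Computable.fst)
      (Computable.snd.comp Computable.fst))).pair
    (he.comp (primrec_pos.to_comp.comp (Computable.fst.comp Computable.snd)
      (Computable.snd.comp Computable.snd)))
  obtain ⟨τ, hτ⟩ := TreeStr.exists_pTimeRel (hP.comp hep) (hL.comp hep)
    (by
      intro m₀ s₀ m₁ s₁ h
      -- A related pair has distinct positions, and the larger cannot be odd by the choice of `e`;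
      -- an even position means second coordinate `0`.
      have h : r (e (pos m₀ s₀)) (e (pos m₁ s₁)) = true := by
        rcases h with h | h <;> simp [r, h]
      rcases lt_trichotomy (pos m₀ s₀) (pos m₁ s₁) with hlt | heq | hlt
      · refine .inl ⟨hlt, ?_⟩
        by_contra hs
        exact absurd (he_odd _ _ hlt (pos_odd hs)) (by simp [h])
      · rw [heq, hrT] at h
        obtain ⟨_, _, h⟩ := h
        exact absurd h (hT.not_near_self _)
      · refine .inr ⟨hlt, ?_⟩
        by_contra hs
        exact absurd (he_odd _ _ hlt (pos_odd hs)) (by rw [r_symm]; simp [h]))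
  let α : ℕ × ℕ ≃ List Bool := Equiv.ofBijective (fun p => str p.1 p.2)
    ⟨fun p q h => Prod.ext (str_injective h).1 (str_injective h).2,
      fun x => let ⟨t, m, h⟩ := exists_eq_str x; ⟨(t, m), h.symm⟩⟩
  let ε : ℕ ≃ D := Equiv.ofBijective (fun n => ⟨e n, he_mem n⟩)
    ⟨fun m n h => he_inj (Subtype.ext_iff.1 h),
      fun a => let ⟨n, h⟩ := (he_range a).2 ((hdD a).1 a.2); ⟨n, Subtype.ext h⟩⟩
  -- A string is sent to `(t, m)`, then to its position, then to the node enumerated there; the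
  -- structure is pulled back along this bijection.
  let φ : List Bool ≃ D :=
    α.symm.trans ((Equiv.ofBijective _ (bijective_pos_zeroArg τ)).trans ε)
  have hφ (t m : ℕ) : φ (str t m) = ⟨e (pos m (zeroArg (τ m) t)), he_mem _⟩ := by
    have : α.symm (str t m) = (t, m) := α.symm_apply_apply (t, m)
    simp only [φ, Equiv.trans_apply, this]
    rfl
  let R : TreeStr (List Bool) :=
    { Pred := fun x y => T.Pred (φ x) (φ y)
      Lt := fun x y => T.Lt (φ x) (φ y)
      root := φ.symm T.root }
  obtain ⟨hR, hR'⟩ := hτ R.Pred R.Lt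
    (fun t₀ m₀ t₁ m₁ => by
      simp only [R, hφ, hPT]
      exact ⟨fun h => ⟨_, _, h⟩, fun ⟨_, _, h⟩ => h⟩)
    (fun t₀ m₀ t₁ m₁ => by
      simp only [R, hφ, hLT]
      exact ⟨fun h => ⟨_, _, h⟩, fun ⟨_, _, h⟩ => h⟩)
  exact ⟨R, ⟨hR, hR'⟩, ⟨{ φ.symm with
    map_pred := fun x y => by simp [R]
    map_lt := fun x y => by simp [R]
    map_root := rfl }⟩⟩
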